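/- Let $K$ be an algebraically closed field of characteristic $0$ (for instance $K=\mathbb C$), let $\delta\in K$ and let $r\ge 0$ be an integer. (No semisimplicity is assumed.) **Partition algebra.** For $k\ge 0$, a diagram is a set partition of $\{1,\dots,k\}\cup\{1',\dots,k'\}$, drawn with a top row $1,\dots,k$ and a bottom row $1',\dots,k'$. For diagrams $\pi,\gamma$, place $\pi$ on top of $\gamma$, identifying the bottom row of $\pi$ with the top row of $\gamma$; let $n(\pi,\gamma)$ be the number of connected components contained entirely in the middle row, and let $\pi\circ\gamma$ be the diagram induced on the top row of $\pi$ and the bottom row of $\gamma$. $\mathcal A_{2k}(\delta)$ is the associative unital $K$-algebra with basis the diagrams and product $\pi\gamma=\delta^{n(\pi,\gamma)}\,\pi\circ\gamma$; its identity is the diagram $\{\{m,m'\}: 1\le m\le k\}$, and $\mathcal A_0(\delta)=K$. For $k\ge 1$, $\mathcal A_{2k-1}(\delta)\subseteq\mathcal A_{2k}(\delta)$ is the subalgebra spanned by the diagrams in which $k$ and $k'$ lie in the same block. Define the following diagrams, in each of which every vertex pair not mentioned forms a block $\{m,m'\}$: $s_i$ ($1\le i\le k-1$) has the blocks $\{i,(i+1)'\}$,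 $\{i+1,i'\}$; $e_{2j-1}$ ($1\le j\le k$) has the blocks $\{j\}$, $\{j'\}$; $e_{2i}$ ($1\le i\le k-1$) has the block $\{i,i+1,i',(i+1)'\}$. **Jucys–Murphy elements.** Put $k=\lceil r/2\rceil$, so that $\mathcal A_r(\delta)\subseteq\mathcal A_{2k}(\delta)$. In $\mathcal A_{2k}(\delta)$ let $L_1=0$, $L_2=e_1$, $\sigma_2=1$, $\sigma_3=s_1$ and, recursively, as far as the indices make sense, for $i\ge 1$ $$L_{2i+2}=s_iL_{2i}s_i-s_iL_{2i}e_{2i}-e_{2i}L_{2i}s_i+e_{2i}L_{2i}e_{2i+1}e_{2i}+\sigma_{2i+1},$$ $$L_{2i+1}=s_iL_{2i-1}s_i-L_{2i}e_{2i}-e_{2i}L_{2i}+(\delta-L_{2i-1})e_{2i}+\sigma_{2i},$$ and for $i\ge 2$ $$\begin{aligned}\sigma_{2i+1}={}&s_{i-1}s_i\sigma_{2i-1}s_is_{i-1}+s_ie_{2i-2}L_{2i-2}s_ie_{2i-2}s_i+e_{2i-2}L_{2i-2}s_ie_{2i-2}\\&-s_ie_{2i-2}L_{2i-2}s_{i-1}e_{2i}e_{2i-1}e_{2i-2}-e_{2i-2}e_{2i-1}e_{2i}s_{i-1}L_{2i-2}e_{2i-2}s_i,\end{aligned}$$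 $$\begin{aligned}\sigma_{2i}={}&s_{i-1}s_i\sigma_{2i-2}s_is_{i-1}+e_{2i-2}L_{2i-2}s_ie_{2i-2}s_i+s_ie_{2i-2}L_{2i-2}s_ie_{2i-2}\\&-e_{2i-2}L_{2i-2}s_{i-1}e_{2i}e_{2i-1}e_{2i-2}-s_ie_{2i-2}e_{2i-1}e_{2i}s_{i-1}L_{2i-2}e_{2i-2}s_i.\end{aligned}$$ The normalised Jucys–Murphy elements are $N_i=L_i-\delta/2$. **Supersymmetric polynomials.** A polynomial $p\in K[x_1,\dots,x_r]$ is *supersymmetric* if it is symmetric in $x_1,x_3,x_5,\dots$, symmetric in $x_2,x_4,x_6,\dots$, and, when $r\ge 2$, the substitution $x_1=y$, $x_2=-y$ turns it into a polynomial independent of $y$. **Theorem.** The elements $N_1,\dots,N_r$ lie in $\mathcal A_r(\delta)$ and commute with each other, so that there is a (unique) $K$-algebra homomorphism $\varphi:K[x_1,\dots,x_r]\to\mathcal A_r(\delta)$ with $\varphi(x_i)=N_i$ for $1\le i\le r$, written $p\mapsto p(N_1,\dots,N_r)$; and for every supersymmetric $p\in K[x_1,\dots,x_r]$ the element $p(N_1,\dots,N_r)$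 lies in the center of $\mathcal A_r(\delta)$. -/

import Mathlib

/-! ### Supersymmetric polynomials -/

/-- Supersymmetric polynomials in `x_1, …, x_r`; the variable `x_m` is `MvPolynomial.X i` with
`i : Fin r` and `m = i + 1`. The cancellation property only makes sense (and is only required)
when both `x_1` and `x_2` are present. -/
structure IsSupersymmetric {K : Type*} [CommRing K] {r : ℕ} (p : MvPolynomial (Fin r) K) :
    Prop where
  /-- `p` is symmetric in `x_1, x_3, x_5, …` -/
  symm_odd : ∀ τ : Equiv.Perm (Fin r), (∀ i : Fin r, Even (i.val + 1) → τ i = i) →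
    MvPolynomial.rename τ p = p
  /-- `p` is symmetric in `x_2, x_4, x_6, …` -/
  symm_even : ∀ τ : Equiv.Perm (Fin r), (∀ i : Fin r, Odd (i.val + 1) → τ i = i) →
    MvPolynomial.rename τ p = p
  /-- substituting `x_1 = y` and `x_2 = -y` yields a polynomial that is independent of `y` -/
  cancellation : 2 ≤ r → ∃ q : MvPolynomial (Fin r) K,
    MvPolynomial.aeval
      (fun i : Fin r => if i.val + 1 = 1 then (Polynomial.X : Polynomial (MvPolynomial (Fin r) K))
        else if i.val + 1 = 2 then -Polynomial.X
        else Polynomial.C (MvPolynomial.X i)) p = Polynomial.C q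

/-! ### Partition diagrams -/

/-- A partition diagram: a set partition (equivalence relation) of two rows of `k` vertices.
For `j : Fin k`, the vertex `(0, j)` is the top vertex `j + 1` and `(1, j)` is the bottom
vertex `(j + 1)'`. -/
abbrev PartitionDiagram (k : ℕ) : Type := Setoid (Fin 2 × Fin k)

namespace PartitionDiagram

/-- The map of `m` rows of `k` vertices into `n` rows of `k` vertices induced by `α`. -/
def rows {m n : ℕ} (k : ℕ) (α : Fin m → Fin n) : Fin m × Fin k → Fin n × Fin k :=
  fun v => (α v.1, v.2)

/-- The number of blocks of a set partition `W` of `X` that contain no point of the image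
of `f`. -/
noncomputable def hidden {X O : Type*} (W : Setoid X) (f : O → X) : ℕ :=
  Nat.card {c : Quotient W // ∀ v : O, Quotient.mk W (f v) ≠ c}

/-- The connected components of `π` stacked on top of `γ`, on three rows of vertices: the bottom
row of `π` is identified with the top row of `γ` and becomes row `1`. -/
def glue {k : ℕ} (π γ : PartitionDiagram k) : Setoid (Fin 3 × Fin k) :=
  Setoid.map π (rows k ![0, 1]) ⊔ Setoid.map γ (rows k ![1, 2])

/-- The product diagram `π ∘ γ`. -/
def comp {k : ℕ} (π γ : PartitionDiagram k) : PartitionDiagram k :=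
  Setoid.comap (rows k ![0, 2]) (glue π γ)

/-- The number `n(π, γ)` of connected components living entirely in the middle row. -/
noncomputable def removed {k : ℕ} (π γ : PartitionDiagram k) : ℕ :=
  hidden (glue π γ) (rows k ![0, 2])

/-- The identity diagram `{{1, 1'}, …, {k, k'}}`. -/
def one (k : ℕ) : PartitionDiagram k := Setoid.ker Prod.snd

/-! ### Associativity and unit laws for diagrams -/

theorem map_rel {X Y : Type*} (r : Setoid X) (f : X → Y) (hf : Function.Injective f) (x y : Y) :
    Setoid.map r f x y ↔ x = y ∨ ∃ a b, r a b ∧ f a = x ∧ f b = y := by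
  have h := Setoid.coe_map_of_ker_le r f
    (fun a b hab => by rw [hf (show f a = f b from hab)])
  rw [h]
  constructor
  · rintro (h | h)
    · exact Or.inr h
    · exact Or.inl h
  · rintro (h | h)
    · exact Or.inr h
    · exact Or.inl h

theorem map_le {X Y : Type*} {r : Setoid X} {f : X → Y} {s : Setoid Y}
    (h : ∀ a b, r a b → s (f a) (f b)) : Setoid.map r f ≤ s :=
  Setoid.eqvGen_le (by rintro _ _ ⟨a, b, hab, rfl, rfl⟩; exact h a b hab)

theorem map_of_rel {X Y : Type*} {r : Setoid X} (f : X → Y) {a b : X} (h : r a b) :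
    Setoid.map r f (f a) (f b) := Relation.EqvGen.rel _ _ ⟨a, b, h, rfl, rfl⟩

theorem map_sup {X Y : Type*} (r s : Setoid X) (f : X → Y) :
    Setoid.map (r ⊔ s) f = Setoid.map r f ⊔ Setoid.map s f := by
  apply le_antisymm
  · apply map_le
    intro a b hab
    have : r ⊔ s ≤ Setoid.comap f (Setoid.map r f ⊔ Setoid.map s f) :=
      sup_le (fun a b h => (le_sup_left : Setoid.map r f ≤ _) (map_of_rel f h))
        (fun a b h => (le_sup_right : Setoid.map s f ≤ _) (map_of_rel f h))
    exact this hab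
  · exact sup_le (map_le fun a b h => map_of_rel f ((le_sup_left : r ≤ r ⊔ s) h))
      (map_le fun a b h => map_of_rel f ((le_sup_right : s ≤ r ⊔ s) h))

theorem map_map {X Y Z : Type*} (r : Setoid X) (f : X → Y) (g : Y → Z) :
    Setoid.map (Setoid.map r f) g = Setoid.map r (g ∘ f) := by
  apply le_antisymm
  · have : Setoid.map r f ≤ Setoid.comap g (Setoid.map r (g ∘ f)) :=
      map_le fun a b h => map_of_rel (g ∘ f) h
    exact map_le fun a b h => this h
  · exact map_le fun a b h => map_of_rel g (map_of_rel f h)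

/-- Restriction commutes with extension along a pullback square of injections. -/
theorem comap_map {A B C X : Type*} (r : Setoid A) (i : A → X) (f : B → X)
    (p : C → A) (q : C → B) (hi : Function.Injective i) (hf : Function.Injective f)
    (hpq : ∀ c, i (p c) = f (q c)) (hpb : ∀ a b, i a = f b → ∃ c, p c = a ∧ q c = b) :
    Setoid.comap f (Setoid.map r i) = Setoid.map (Setoid.comap p r) q := by
  apply le_antisymm
  · intro x y h
    rcases (map_rel r i hi _ _).1 h with h | ⟨a, b, hab, ha, hb⟩
    · rw [hf h]
    · obtain ⟨c, rfl, rfl⟩ := hpb a x ha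
      obtain ⟨d, rfl, rfl⟩ := hpb b y hb
      exact map_of_rel q hab
  · apply map_le
    intro a b hab
    show Setoid.map r i (f (q a)) (f (q b))
    rw [← hpq, ← hpq]
    exact map_of_rel i hab

theorem hidden_map {A B C X : Type*} (r : Setoid A) (i : A → X) (f : B → X)
    (p : C → A) (q : C → B) (hi : Function.Injective i)
    (hpq : ∀ c, i (p c) = f (q c)) (hpb : ∀ a b, i a = f b → ∃ c, p c = a ∧ q c = b)
    (hcov : ∀ x, (∃ a, i a = x) ∨ ∃ b, f b = x) :
    hidden (Setoid.map r i) f = hidden r p := by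
  symm
  have rel : ∀ a b, Setoid.map r i (i a) (i b) ↔ r a b := by
    intro a b
    rw [map_rel r i hi]
    constructor
    · rintro (h | ⟨a', b', h, ha, hb⟩)
      · rw [hi h]
      · rwa [hi ha, hi hb] at h
    · intro h
      exact Or.inr ⟨a, b, h, rfl, rfl⟩
  let F : Quotient r → Quotient (Setoid.map r i) :=
    Quotient.map' i (fun a b h => (rel a b).2 h)
  refine Nat.card_congr (Equiv.ofBijective
    (fun c => ⟨F c.1, ?_⟩ : {c : Quotient r // ∀ v : C, Quotient.mk r (p v) ≠ c} →
      {c : Quotient (Setoid.map r i) // ∀ v : B, Quotient.mk _ (f v) ≠ c}) ⟨?_, ?_⟩)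
  · obtain ⟨c, hc⟩ := c
    induction c using Quotient.inductionOn with
    | _ a =>
      intro v hv
      rcases (map_rel r i hi _ _).1 (Quotient.exact hv) with h | ⟨a', b', h, ha, hb⟩
      · obtain ⟨d, rfl, rfl⟩ := hpb a v h.symm
        exact hc d rfl
      · obtain ⟨d, rfl, rfl⟩ := hpb a' v ha
        rw [hi hb] at h
        exact hc d (Quotient.sound h)
  · rintro ⟨c, hc⟩ ⟨d, hd⟩ h
    induction c using Quotient.inductionOn with
    | _ a =>
      induction d using Quotient.inductionOn with
      | _ b =>
        apply Subtype.ext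
        exact Quotient.sound ((rel a b).1 (Quotient.exact (congrArg Subtype.val h)))
  · rintro ⟨c, hc⟩
    induction c using Quotient.inductionOn with
    | _ x =>
      rcases hcov x with ⟨a, rfl⟩ | ⟨b, rfl⟩
      · refine ⟨⟨Quotient.mk r a, ?_⟩, rfl⟩
        intro v hv
        apply hc (q v)
        rw [← hpq]
        exact Quotient.sound ((rel _ _).2 (Quotient.exact hv))
      · exact absurd rfl (hc b)

/-- The classes missed by `f ∘ g` are those missed by `f`, and those met by `f` but
missed by `f ∘ g`. -/
theorem hidden_comp {X Y O : Type*} [Finite X] [Finite Y] (W : Setoid X) (f : Y → X) (g : O → Y) :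
    hidden W (f ∘ g) = hidden W f + hidden (Setoid.comap f W) g := by
  unfold hidden
  rw [← Nat.card_sum]
  symm
  let G : Quotient (Setoid.comap f W) → Quotient W := Quotient.map' f (fun a b h => h)
  have hG : Function.Injective G := by
    intro c d h
    induction c using Quotient.inductionOn with
    | _ a =>
      induction d using Quotient.inductionOn with
      | _ b => exact Quotient.sound (show W (f a) (f b) from Quotient.exact h)
  refine Nat.card_congr (Equiv.ofBijective
    (Sum.elim (fun c => ⟨c.1, fun v => c.2 (g v)⟩)
      (fun c => ⟨G c.1, fun v hv => c.2 v (hG hv)⟩) : _ →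
      {c : Quotient W // ∀ v : O, Quotient.mk W ((f ∘ g) v) ≠ c}) ⟨?_, ?_⟩)
  · have key : ∀ (c : Quotient W) (d : Quotient (Setoid.comap f W)),
        (∀ v, Quotient.mk W (f v) ≠ c) → c ≠ G d := by
      intro c d hc h
      induction d using Quotient.inductionOn with
      | _ b => exact hc b h.symm
    rintro (⟨c, hc⟩ | ⟨c, hc⟩) (⟨d, hd⟩ | ⟨d, hd⟩) h
    · have := congrArg Subtype.val h
      simp only [Sum.elim_inl] at this
      subst this
      rfl
    · exact absurd (congrArg Subtype.val h) (key c d hc)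
    · exact absurd (congrArg Subtype.val h).symm (key d c hd)
    · have := hG (congrArg Subtype.val h)
      subst this
      rfl
  · rintro ⟨c, hc⟩
    by_cases h : ∀ v, Quotient.mk W (f v) ≠ c
    · exact ⟨Sum.inl ⟨c, h⟩, rfl⟩
    · push Not at h
      obtain ⟨v, rfl⟩ := h
      exact ⟨Sum.inr ⟨Quotient.mk _ v, fun u hu => hc u (congrArg G hu)⟩, rfl⟩

open Classical in
/-- A complete invariant of the classes of `R ⊔ S` when `S` only identifies points in the image
of `f`. -/
noncomputable def restrictInv {X Y : Type*} (R S : Setoid X) (f : Y → X) (x : X) :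
    Quotient (Setoid.comap f R ⊔ Setoid.comap f S) ⊕ Quotient R :=
  if h : ∃ a, R (f a) x then Sum.inl (Quotient.mk _ h.choose) else Sum.inr (Quotient.mk _ x)

theorem restrictInv_of {X Y : Type*} (R S : Setoid X) (f : Y → X)
    {x : X} {a : Y} (h : R (f a) x) :
    restrictInv R S f x = Sum.inl (Quotient.mk _ a) := by
  have h' : ∃ a, R (f a) x := ⟨a, h⟩
  rw [restrictInv, dif_pos h']
  refine congrArg Sum.inl (Quotient.sound ?_)
  exact (le_sup_left : Setoid.comap f R ≤ _ ⊔ Setoid.comap f S)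
    (show R _ _ from R.trans h'.choose_spec (R.symm h))

theorem sup_le_restrictInv {X Y : Type*} (R S : Setoid X) (f : Y → X)
    (hS : ∀ x y, S x y → x = y ∨ ((∃ a, f a = x) ∧ ∃ b, f b = y)) :
    R ⊔ S ≤ Setoid.ker (restrictInv R S f) := by
  apply sup_le
  · intro x y hxy
    show restrictInv R S f x = restrictInv R S f y
    by_cases h : ∃ a, R (f a) x
    · obtain ⟨a, ha⟩ := h
      rw [restrictInv_of R S f ha, restrictInv_of R S f (R.trans ha hxy)]
    · have h' : ¬ ∃ a, R (f a) y := fun ⟨a, ha⟩ => h ⟨a, R.trans ha (R.symm hxy)⟩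
      rw [restrictInv, restrictInv, dif_neg h, dif_neg h']
      exact congrArg Sum.inr (Quotient.sound hxy)
  · intro x y hxy
    show restrictInv R S f x = restrictInv R S f y
    rcases hS x y hxy with rfl | ⟨⟨a, rfl⟩, ⟨b, rfl⟩⟩
    · rfl
    · rw [restrictInv_of R S f (R.refl (f a)), restrictInv_of R S f (R.refl (f b))]
      refine congrArg Sum.inl (Quotient.sound ?_)
      exact (le_sup_right : Setoid.comap f S ≤ Setoid.comap f R ⊔ _) hxy

theorem comap_sup {X Y : Type*} (R S : Setoid X) (f : Y → X)
    (hS : ∀ x y, S x y → x = y ∨ ((∃ a, f a = x) ∧ ∃ b, f b = y)) :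
    Setoid.comap f (R ⊔ S) = Setoid.comap f R ⊔ Setoid.comap f S := by
  apply le_antisymm
  · intro a b hab
    have h := sup_le_restrictInv R S f hS hab
    have h : restrictInv R S f (f a) = restrictInv R S f (f b) := h
    rw [restrictInv_of R S f (R.refl (f a)), restrictInv_of R S f (R.refl (f b))] at h
    exact Quotient.exact (Sum.inl.inj h)
  · exact sup_le (fun a b h => (le_sup_left : R ≤ R ⊔ S) h)
      (fun a b h => (le_sup_right : S ≤ R ⊔ S) h)

theorem hidden_sup {X Y : Type*} (R S : Setoid X) (f : Y → X)
    (hS : ∀ x y, S x y → x = y ∨ ((∃ a, f a = x) ∧ ∃ b, f b = y)) :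
    hidden (R ⊔ S) f = hidden R f := by
  symm
  have inv : ∀ x y, (R ⊔ S) x y → (∀ a, ¬ R (f a) x) → R x y := by
    intro x y hxy hx
    have h : restrictInv R S f x = restrictInv R S f y := sup_le_restrictInv R S f hS hxy
    have hx' : ¬ ∃ a, R (f a) x := fun ⟨a, ha⟩ => hx a ha
    by_cases hy : ∃ a, R (f a) y
    · obtain ⟨a, ha⟩ := hy
      rw [restrictInv_of R S f ha, restrictInv, dif_neg hx'] at h
      cases h
    · rw [restrictInv, restrictInv, dif_neg hx', dif_neg hy] at h
      exact Quotient.exact (Sum.inr.inj h)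
  let F : Quotient R → Quotient (R ⊔ S) :=
    Quotient.map' id (fun a b h => (le_sup_left : R ≤ R ⊔ S) h)
  refine Nat.card_congr (Equiv.ofBijective
    (fun c => ⟨F c.1, ?_⟩ : {c : Quotient R // ∀ v : Y, Quotient.mk R (f v) ≠ c} →
      {c : Quotient (R ⊔ S) // ∀ v : Y, Quotient.mk _ (f v) ≠ c}) ⟨?_, ?_⟩)
  · obtain ⟨c, hc⟩ := c
    induction c using Quotient.inductionOn with
    | _ x =>
      intro v hv
      have hx : ∀ a, ¬ R (f a) x := fun a ha => hc a (Quotient.sound ha)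
      exact hx v (R.symm (inv x (f v) ((R ⊔ S).symm (Quotient.exact hv)) hx))
  · rintro ⟨c, hc⟩ ⟨d, hd⟩ h
    induction c using Quotient.inductionOn with
    | _ x =>
      induction d using Quotient.inductionOn with
      | _ y =>
        apply Subtype.ext
        exact Quotient.sound (inv x y (Quotient.exact (congrArg Subtype.val h))
          (fun a ha => hc a (Quotient.sound ha)))
  · rintro ⟨c, hc⟩
    induction c using Quotient.inductionOn with
    | _ x =>
      refine ⟨⟨Quotient.mk R x, ?_⟩, rfl⟩
      intro v hv
      exact hc v (Quotient.sound ((le_sup_left : R ≤ R ⊔ S) (Quotient.exact hv)))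

theorem rows_injective {m n k : ℕ} {α : Fin m → Fin n} (h : Function.Injective α) :
    Function.Injective (rows k α) := by
  rintro ⟨a, i⟩ ⟨b, j⟩ hab
  simp only [rows, Prod.mk.injEq] at hab
  exact Prod.ext (h hab.1) hab.2

theorem rows_pullback {a b c n k : ℕ} {i : Fin a → Fin n} {f : Fin b → Fin n}
    {p : Fin c → Fin a} {q : Fin c → Fin b}
    (h : ∀ x y, i x = f y → ∃ z, p z = x ∧ q z = y) (x : Fin a × Fin k) (y : Fin b × Fin k)
    (hxy : rows k i x = rows k f y) : ∃ z, rows k p z = x ∧ rows k q z = y := by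
  obtain ⟨x, u⟩ := x
  obtain ⟨y, v⟩ := y
  simp only [rows, Prod.mk.injEq] at hxy
  obtain ⟨hxy, rfl⟩ := hxy
  obtain ⟨z, rfl, rfl⟩ := h x y hxy
  exact ⟨(z, u), rfl, rfl⟩

theorem rows_cover {a b n k : ℕ} {i : Fin a → Fin n} {f : Fin b → Fin n}
    (h : ∀ x, (∃ y, i y = x) ∨ ∃ y, f y = x) (x : Fin n × Fin k) :
    (∃ y, rows k i y = x) ∨ ∃ y, rows k f y = x := by
  obtain ⟨x, u⟩ := x
  rcases h x with ⟨y, rfl⟩ | ⟨y, rfl⟩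
  · exact Or.inl ⟨(y, u), rfl⟩
  · exact Or.inr ⟨(y, u), rfl⟩

theorem rows_eq {a b c d k : ℕ} {i : Fin a → Fin b} {f : Fin b → Fin d} {p : Fin a → Fin c}
    {q : Fin c → Fin d} (h : ∀ x, f (i x) = q (p x)) :
    rows k f ∘ rows k i = rows k q ∘ rows k p := by
  funext x
  simp only [rows, Function.comp, h]

/-- Four rows, with a diagram between rows `0, 1`, rows `1, 2` and rows `2, 3`. -/
def glue₄ {k : ℕ} (π γ ρ : PartitionDiagram k) : Setoid (Fin 4 × Fin k) :=
  Setoid.map π (rows k ![0, 1]) ⊔ Setoid.map γ (rows k ![1, 2]) ⊔ Setoid.map ρ (rows k ![2, 3])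

theorem map_rows_rel {m n k : ℕ} {b : ℕ} {i : Fin m → Fin n} {f : Fin b → Fin n}
    (hi : Function.Injective i) (r : Setoid (Fin m × Fin k)) (h : ∀ x, ∃ y, f y = i x)
    (x y : Fin n × Fin k) (hxy : Setoid.map r (rows k i) x y) :
    x = y ∨ ((∃ a, rows k f a = x) ∧ ∃ b, rows k f b = y) := by
  rcases (map_rel r _ (rows_injective hi) x y).1 hxy with h' | ⟨⟨a, u⟩, ⟨b, v⟩, -, rfl, rfl⟩
  · exact Or.inl h'
  · obtain ⟨a', ha⟩ := h a
    obtain ⟨b', hb⟩ := h b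
    exact Or.inr ⟨⟨(a', u), by simp only [rows, ha]⟩, ⟨(b', v), by simp only [rows, hb]⟩⟩

theorem glue₄_eq_left {k : ℕ} (π γ ρ : PartitionDiagram k) : glue₄ π γ ρ =
    Setoid.map (glue π γ) (rows k ![0, 1, 2]) ⊔ Setoid.map ρ (rows k ![2, 3]) := by
  rw [glue, map_sup, map_map, map_map, glue₄]
  congr 3
  · funext ⟨a, u⟩
    fin_cases a <;> rfl
  · funext ⟨a, u⟩
    fin_cases a <;> rfl

theorem glue₄_eq_right {k : ℕ} (π γ ρ : PartitionDiagram k) : glue₄ π γ ρ =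
    Setoid.map (glue γ ρ) (rows k ![1, 2, 3]) ⊔ Setoid.map π (rows k ![0, 1]) := by
  rw [glue, map_sup, map_map, map_map, glue₄, sup_assoc, sup_comm]
  congr 3
  · funext ⟨a, u⟩
    fin_cases a <;> rfl
  · funext ⟨a, u⟩
    fin_cases a <;> rfl

theorem comap_glue₄_left {k : ℕ} (π γ ρ : PartitionDiagram k) :
    Setoid.comap (rows k ![0, 2, 3]) (glue₄ π γ ρ) = glue (comp π γ) ρ := by
  rw [glue₄_eq_left, comap_sup _ _ _ (map_rows_rel (by decide) ρ (by decide))]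
  unfold glue comp
  congr 1
  · exact comap_map _ _ _ (rows k ![0, 2]) (rows k ![0, 1]) (rows_injective (by decide))
      (rows_injective (by decide)) (congrFun (rows_eq (by decide))) (rows_pullback (by decide))
  · rw [comap_map ρ (rows k ![2, 3]) (rows k ![0, 2, 3]) (rows k ![0, 1]) (rows k ![1, 2])
      (rows_injective (by decide)) (rows_injective (by decide)) (congrFun (rows_eq (by decide)))
      (rows_pullback (by decide))]
    congr 1
    have : rows k ![(0 : Fin 2), 1] = id := by
      funext ⟨a, u⟩
      fin_cases a <;> rfl
    rw [this]
    rfl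

theorem comap_glue₄_right {k : ℕ} (π γ ρ : PartitionDiagram k) :
    Setoid.comap (rows k ![0, 1, 3]) (glue₄ π γ ρ) = glue π (comp γ ρ) := by
  rw [glue₄_eq_right, comap_sup _ _ _ (map_rows_rel (by decide) π (by decide)), sup_comm]
  unfold glue comp
  congr 1
  · rw [comap_map π (rows k ![0, 1]) (rows k ![0, 1, 3]) (rows k ![0, 1]) (rows k ![0, 1])
      (rows_injective (by decide)) (rows_injective (by decide)) (congrFun (rows_eq (by decide)))
      (rows_pullback (by decide))]
    congr 1
    have : rows k ![(0 : Fin 2), 1] = id := by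
      funext ⟨a, u⟩
      fin_cases a <;> rfl
    rw [this]
    rfl
  · exact comap_map _ _ _ (rows k ![0, 2]) (rows k ![1, 2]) (rows_injective (by decide))
      (rows_injective (by decide)) (congrFun (rows_eq (by decide))) (rows_pullback (by decide))

theorem comp_left_eq {k : ℕ} (π γ ρ : PartitionDiagram k) :
    comp (comp π γ) ρ = Setoid.comap (rows k ![0, 3]) (glue₄ π γ ρ) := by
  rw [comp, ← comap_glue₄_left]
  have : rows k ![(0 : Fin 4), 3] = rows k ![0, 2, 3] ∘ rows k ![0, 2] := by
    funext ⟨a, u⟩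
    fin_cases a <;> rfl
  rw [this]
  rfl

theorem comp_assoc {k : ℕ} (π γ ρ : PartitionDiagram k) :
    comp (comp π γ) ρ = comp π (comp γ ρ) := by
  rw [comp_left_eq, comp, ← comap_glue₄_right]
  have : rows k ![(0 : Fin 4), 3] = rows k ![0, 1, 3] ∘ rows k ![0, 2] := by
    funext ⟨a, u⟩
    fin_cases a <;> rfl
  rw [this]
  rfl

theorem removed_left {k : ℕ} (π γ ρ : PartitionDiagram k) :
    removed π γ + removed (comp π γ) ρ = hidden (glue₄ π γ ρ) (rows k ![0, 3]) := by
  have : rows k ![(0 : Fin 4), 3] = rows k ![0, 2, 3] ∘ rows k ![0, 2] := by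
    funext ⟨a, u⟩
    fin_cases a <;> rfl
  rw [this, hidden_comp, comap_glue₄_left, glue₄_eq_left,
    hidden_sup _ _ _ (map_rows_rel (by decide) ρ (by decide)),
    hidden_map _ _ _ (rows k ![0, 2]) (rows k ![0, 1]) (rows_injective (by decide))
      (congrFun (rows_eq (by decide))) (rows_pullback (by decide)) (rows_cover (by decide))]
  rfl

theorem removed_assoc {k : ℕ} (π γ ρ : PartitionDiagram k) :
    removed π γ + removed (comp π γ) ρ = removed γ ρ + removed π (comp γ ρ) := by
  have : rows k ![(0 : Fin 4), 3] = rows k ![0, 1, 3] ∘ rows k ![0, 2] := by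
    funext ⟨a, u⟩
    fin_cases a <;> rfl
  rw [removed_left, this, hidden_comp, comap_glue₄_right, glue₄_eq_right,
    hidden_sup _ _ _ (map_rows_rel (by decide) π (by decide)),
    hidden_map _ _ _ (rows k ![0, 2]) (rows k ![1, 2]) (rows_injective (by decide))
      (congrFun (rows_eq (by decide))) (rows_pullback (by decide)) (rows_cover (by decide))]
  rfl

theorem glue_left {k : ℕ} (π γ : PartitionDiagram k) {v w : Fin 2 × Fin k} (h : π v w) :
    glue π γ (rows k ![0, 1] v) (rows k ![0, 1] w) :=
  (le_sup_left : Setoid.map π _ ≤ _ ⊔ Setoid.map γ _) (map_of_rel _ h)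

theorem glue_right {k : ℕ} (π γ : PartitionDiagram k) {v w : Fin 2 × Fin k} (h : γ v w) :
    glue π γ (rows k ![1, 2] v) (rows k ![1, 2] w) :=
  (le_sup_right : Setoid.map γ _ ≤ Setoid.map π _ ⊔ _) (map_of_rel _ h)

theorem glue_one_left {k : ℕ} (γ : PartitionDiagram k) :
    glue (one k) γ = Setoid.comap (rows k ![0, 0, 1]) γ := by
  have e : ∀ j : Fin k, glue (one k) γ (0, j) (1, j) := fun j =>
    glue_left (one k) γ (v := (0, j)) (w := (1, j)) rfl
  have e' : ∀ v : Fin 3 × Fin k,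
      glue (one k) γ v (rows k ![1, 2] (rows k ![0, 0, 1] v)) := by
    rintro ⟨a, j⟩
    fin_cases a
    · exact e j
    · exact (glue (one k) γ).refl _
    · exact (glue (one k) γ).refl _
  apply le_antisymm
  · refine sup_le (map_le ?_) (map_le ?_)
    · rintro ⟨a, i⟩ ⟨b, j⟩ h
      obtain rfl : i = j := h
      fin_cases a <;> fin_cases b <;> exact γ.refl _
    · rintro ⟨a, i⟩ ⟨b, j⟩ h
      fin_cases a <;> fin_cases b <;> exact h
  · intro v w h
    exact (glue (one k) γ).trans (e' v)
      ((glue (one k) γ).trans (glue_right _ _ h) ((glue (one k) γ).symm (e' w)))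

theorem glue_one_right {k : ℕ} (π : PartitionDiagram k) :
    glue π (one k) = Setoid.comap (rows k ![0, 1, 1]) π := by
  have e : ∀ j : Fin k, glue π (one k) (2, j) (1, j) := fun j =>
    glue_right π (one k) (v := (1, j)) (w := (0, j)) rfl
  have e' : ∀ v : Fin 3 × Fin k,
      glue π (one k) v (rows k ![0, 1] (rows k ![0, 1, 1] v)) := by
    rintro ⟨a, j⟩
    fin_cases a
    · exact (glue π (one k)).refl _
    · exact (glue π (one k)).refl _
    · exact e j
  apply le_antisymm
  · refine sup_le (map_le ?_) (map_le ?_)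
    · rintro ⟨a, i⟩ ⟨b, j⟩ h
      fin_cases a <;> fin_cases b <;> exact h
    · rintro ⟨a, i⟩ ⟨b, j⟩ h
      obtain rfl : i = j := h
      fin_cases a <;> fin_cases b <;> exact π.refl _
  · intro v w h
    exact (glue π (one k)).trans (e' v)
      ((glue π (one k)).trans (glue_left _ _ h) ((glue π (one k)).symm (e' w)))

theorem hidden_eq_zero {X O : Type*} (W : Setoid X) (f : O → X) (h : ∀ x, ∃ v, W (f v) x) :
    hidden W f = 0 := by
  have : IsEmpty {c : Quotient W // ∀ v : O, Quotient.mk W (f v) ≠ c} := by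
    refine ⟨?_⟩
    rintro ⟨c, hc⟩
    induction c using Quotient.inductionOn with
    | _ x =>
      obtain ⟨v, hv⟩ := h x
      exact hc v (Quotient.sound hv)
  exact Nat.card_of_isEmpty

theorem one_comp {k : ℕ} (γ : PartitionDiagram k) : comp (one k) γ = γ := by
  rw [comp, glue_one_left]
  ext ⟨a, i⟩ ⟨b, j⟩
  fin_cases a <;> fin_cases b <;> rfl

theorem comp_one {k : ℕ} (π : PartitionDiagram k) : comp π (one k) = π := by
  rw [comp, glue_one_right]
  ext ⟨a, i⟩ ⟨b, j⟩
  fin_cases a <;> fin_cases b <;> rfl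

theorem removed_one_left {k : ℕ} (γ : PartitionDiagram k) : removed (one k) γ = 0 := by
  apply hidden_eq_zero
  rintro ⟨a, j⟩
  rw [glue_one_left]
  fin_cases a
  · exact ⟨(0, j), γ.refl _⟩
  · exact ⟨(0, j), γ.refl _⟩
  · exact ⟨(1, j), γ.refl _⟩

theorem removed_one_right {k : ℕ} (π : PartitionDiagram k) : removed π (one k) = 0 := by
  apply hidden_eq_zero
  rintro ⟨a, j⟩
  rw [glue_one_right]
  fin_cases a
  · exact ⟨(0, j), π.refl _⟩
  · exact ⟨(1, j), π.refl _⟩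
  · exact ⟨(1, j), π.refl _⟩

end PartitionDiagram

/-! ### The partition algebra on `2k` vertices -/

/-- The partition algebra `A_{2k}(δ)` over `K`: formal linear combinations of partition diagrams,
with `π * γ = δ ^ n(π, γ) • (π ∘ γ)`. -/
def DiagramAlgebra {K : Type*} [Field K] (δ : K) (k : ℕ) : Type _ :=
  let _ := δ
  PartitionDiagram k →₀ K

namespace DiagramAlgebra

variable {K : Type*} [Field K] {δ : K} {k : ℕ}

noncomputable instance : AddCommGroup (DiagramAlgebra δ k) :=
  inferInstanceAs (AddCommGroup (PartitionDiagram k →₀ K))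

noncomputable instance : Module K (DiagramAlgebra δ k) :=
  inferInstanceAs (Module K (PartitionDiagram k →₀ K))

variable (δ) in
/-- The basis element given by a diagram. -/
noncomputable def diagram (π : PartitionDiagram k) : DiagramAlgebra δ k :=
  (Finsupp.single π (1 : K) : PartitionDiagram k →₀ K)

variable (δ k) in
/-- The diagrams form a basis. -/
noncomputable def basis : Module.Basis (PartitionDiagram k) K (DiagramAlgebra δ k) :=
  Module.Basis.ofRepr (LinearEquiv.refl K (PartitionDiagram k →₀ K))

theorem basis_apply (π : PartitionDiagram k) : basis δ k π = diagram δ π := rfl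

variable (δ k) in
/-- The multiplication as a bilinear map, given by its values on diagrams. -/
noncomputable def mulBilin :
    DiagramAlgebra δ k →ₗ[K] DiagramAlgebra δ k →ₗ[K] DiagramAlgebra δ k :=
  (basis δ k).constr K fun π => (basis δ k).constr K fun γ =>
    δ ^ PartitionDiagram.removed π γ • diagram δ (PartitionDiagram.comp π γ)

noncomputable instance : Mul (DiagramAlgebra δ k) := ⟨fun a b => mulBilin δ k a b⟩

noncomputable instance : One (DiagramAlgebra δ k) := ⟨diagram δ (PartitionDiagram.one k)⟩

theorem one_def : (1 : DiagramAlgebra δ k) = diagram δ (PartitionDiagram.one k) := rfl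

theorem mul_def (a b : DiagramAlgebra δ k) : a * b = mulBilin δ k a b := rfl

theorem diagram_mul_diagram (π γ : PartitionDiagram k) : diagram δ π * diagram δ γ =
    δ ^ PartitionDiagram.removed π γ • diagram δ (PartitionDiagram.comp π γ) := by
  rw [mul_def, mulBilin, ← basis_apply, ← basis_apply, Module.Basis.constr_basis,
    Module.Basis.constr_basis]

theorem smul_mul' (c : K) (a b : DiagramAlgebra δ k) : c • a * b = c • (a * b) := by
  simp only [mul_def, map_smul, LinearMap.smul_apply]

theorem mul_smul' (c : K) (a b : DiagramAlgebra δ k) : a * c • b = c • (a * b) := by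
  simp only [mul_def, map_smul]

theorem one_mul' (a : DiagramAlgebra δ k) : 1 * a = a := by
  have : mulBilin δ k 1 = LinearMap.id := by
    refine (basis δ k).ext fun π => ?_
    rw [basis_apply, ← mul_def, one_def, diagram_mul_diagram, PartitionDiagram.one_comp,
      PartitionDiagram.removed_one_left, pow_zero, one_smul, LinearMap.id_apply]
  rw [mul_def, this, LinearMap.id_apply]

theorem mul_one' (a : DiagramAlgebra δ k) : a * 1 = a := by
  have : (mulBilin δ k).flip 1 = LinearMap.id := by
    refine (basis δ k).ext fun π => ?_
    rw [basis_apply, LinearMap.flip_apply, ← mul_def, one_def, diagram_mul_diagram,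
      PartitionDiagram.comp_one, PartitionDiagram.removed_one_right, pow_zero, one_smul,
      LinearMap.id_apply]
  rw [mul_def, ← LinearMap.flip_apply, this, LinearMap.id_apply]

theorem mul_assoc' (a b c : DiagramAlgebra δ k) : a * b * c = a * (b * c) := by
  have h1 : (mulBilin δ k).compr₂ (mulBilin δ k) =
      LinearMap.mk₂ K (fun a b => mulBilin δ k a ∘ₗ mulBilin δ k b)
        (fun _ _ _ => by rw [map_add, LinearMap.add_comp])
        (fun _ _ _ => by rw [map_smul, LinearMap.smul_comp])
        (fun _ _ _ => by rw [map_add, LinearMap.comp_add])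
        (fun _ _ _ => by rw [map_smul, LinearMap.comp_smul]) := by
    refine (basis δ k).ext fun π => (basis δ k).ext fun γ => (basis δ k).ext fun ρ => ?_
    simp only [basis_apply, LinearMap.compr₂_apply, LinearMap.mk₂_apply, LinearMap.comp_apply,
      ← mul_def]
    rw [diagram_mul_diagram, diagram_mul_diagram, smul_mul', mul_smul', diagram_mul_diagram,
      diagram_mul_diagram, smul_smul, smul_smul, ← pow_add, ← pow_add,
      PartitionDiagram.removed_assoc, PartitionDiagram.comp_assoc]
  exact LinearMap.congr_fun (LinearMap.congr_fun (LinearMap.congr_fun h1 a) b) c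

noncomputable instance : Ring (DiagramAlgebra δ k) :=
  { (inferInstance : AddCommGroup (DiagramAlgebra δ k)) with
    mul := (· * ·)
    one := 1
    left_distrib := fun a b c => by simp only [mul_def, map_add]
    right_distrib := fun a b c => by simp only [mul_def, map_add, LinearMap.add_apply]
    zero_mul := fun a => by simp only [mul_def, map_zero, LinearMap.zero_apply]
    mul_zero := fun a => by simp only [mul_def, map_zero]
    mul_assoc := mul_assoc'
    one_mul := one_mul'
    mul_one := mul_one' }

noncomputable instance : Algebra K (DiagramAlgebra δ k) :=
  Algebra.ofModule smul_mul' (fun c a b => mul_smul' c a b)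

/-! ### Generators -/

variable (δ k) in
/-- The generator `s_i` (`1 ≤ i ≤ k - 1`), with blocks `{i, (i+1)'}`, `{i+1, i'}` and `{m, m'}`
for the other `m`. -/
noncomputable def s (i : ℕ) : DiagramAlgebra δ k :=
  diagram δ (Setoid.ker fun v : Fin 2 × Fin k =>
    if v.1 = 0 then v.2.val + 1 else Equiv.swap i (i + 1) (v.2.val + 1))

variable (δ k) in
/-- The generator `e_{2j-1}` (`1 ≤ j ≤ k`), with blocks `{j}`, `{j'}` and `{m, m'}` for
the other `m`. -/
noncomputable def eOdd (j : ℕ) : DiagramAlgebra δ k :=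
  diagram δ (Setoid.ker fun v : Fin 2 × Fin k =>
    (v.2.val + 1, if v.2.val + 1 = j then v.1 else 0))

variable (δ k) in
/-- The generator `e_{2i}` (`1 ≤ i ≤ k - 1`), with blocks `{i, i+1, i', (i+1)'}` and `{m, m'}`
for the other `m`. -/
noncomputable def eEven (i : ℕ) : DiagramAlgebra δ k :=
  diagram δ (Setoid.ker fun v : Fin 2 × Fin k =>
    if v.2.val + 1 = i + 1 then i else v.2.val + 1)

variable (δ k) in
/-- The generators `e_1, …, e_{2k-1}`. -/
noncomputable def e (n : ℕ) : DiagramAlgebra δ k :=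
  if Even n then eEven δ k (n / 2) else eOdd δ k ((n + 1) / 2)

end DiagramAlgebra

/-! ### Jucys–Murphy elements -/

/-- The four elements `L_{2i-1}`, `L_{2i}`, `σ_{2i}`, `σ_{2i+1}` for one value of `i ≥ 1`. -/
structure JMData (A : Type*) where
  /-- `L_{2i-1}` -/
  Lodd : A
  /-- `L_{2i}` -/
  Leven : A
  /-- `σ_{2i}` -/
  σeven : A
  /-- `σ_{2i+1}` -/
  σodd : A

namespace DiagramAlgebra

variable {K : Type*} [Field K]

/-- Enyang's recursion; `jmData δ k m` holds `L_{2m+1}`, `L_{2m+2}`, `σ_{2m+2}`, `σ_{2m+3}`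
as elements of `A_{2k}(δ)`. The elements `L_n` with `n ≤ 2k` and `σ_n` with `n ≤ 2k - 1` involve
only the generators `s_i` with `1 ≤ i ≤ k - 1` and `e_j` with `1 ≤ j ≤ 2k - 1`. -/
noncomputable def jmData (δ : K) (k : ℕ) : ℕ → JMData (DiagramAlgebra δ k)
  | 0 => { Lodd := 0, Leven := e δ k 1, σeven := 1, σodd := s δ k 1 }
  | m + 1 =>
    let D := jmData δ k m
    let s₁ := s δ k (m + 1)
    let s₂ := s δ k (m + 2)
    let e₂ := e δ k (2 * m + 2)
    let e₃ := e δ k (2 * m + 3)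
    let e₄ := e δ k (2 * m + 4)
    { Lodd := s₁ * D.Lodd * s₁ - D.Leven * e₂ - e₂ * D.Leven
        + (algebraMap K _ δ - D.Lodd) * e₂ + D.σeven
      Leven := s₁ * D.Leven * s₁ - s₁ * D.Leven * e₂ - e₂ * D.Leven * s₁
        + e₂ * D.Leven * e₃ * e₂ + D.σodd
      σeven := s₁ * s₂ * D.σeven * s₂ * s₁ + e₂ * D.Leven * s₂ * e₂ * s₂
        + s₂ * e₂ * D.Leven * s₂ * e₂ - e₂ * D.Leven * s₁ * e₄ * e₃ * e₂
        - s₂ * e₂ * e₃ * e₄ * s₁ * D.Leven * e₂ * s₂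
      σodd := s₁ * s₂ * D.σodd * s₂ * s₁ + s₂ * e₂ * D.Leven * s₂ * e₂ * s₂
        + e₂ * D.Leven * s₂ * e₂ - s₂ * e₂ * D.Leven * s₁ * e₄ * e₃ * e₂
        - e₂ * e₃ * e₄ * s₁ * D.Leven * e₂ * s₂ }

/-- The Jucys–Murphy element `L_n` (`1 ≤ n ≤ 2k`) in `A_{2k}(δ)`. -/
noncomputable def L (δ : K) (k n : ℕ) : DiagramAlgebra δ k :=
  if Odd n then (jmData δ k ((n - 1) / 2)).Lodd else (jmData δ k ((n - 1) / 2)).Leven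

/-- The normalised Jucys–Murphy element `N_n = L_n - δ/2`. -/
noncomputable def N (δ : K) (k n : ℕ) : DiagramAlgebra δ k :=
  L δ k n - algebraMap K _ (δ / 2)

end DiagramAlgebra

/-! ### The partition algebra `A_r(δ)` -/

/-- The diagrams spanning `A_r(δ)` inside `A_{2k}(δ)`, `k = ⌈r/2⌉`: all of them if `r = 2k`, and
those with `k` and `k'` in the same block if `r = 2k - 1`. -/
def IsDiagramOf (r : ℕ) (π : PartitionDiagram ((r + 1) / 2)) : Prop :=
  Odd r → ∀ j : Fin ((r + 1) / 2), j.val + 1 = (r + 1) / 2 → π (0, j) (1, j)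

theorem IsDiagramOf.comp {r : ℕ} {π γ : PartitionDiagram ((r + 1) / 2)} (hπ : IsDiagramOf r π)
    (hγ : IsDiagramOf r γ) : IsDiagramOf r (PartitionDiagram.comp π γ) := fun hr j hj =>
  (PartitionDiagram.glue π γ).trans (PartitionDiagram.glue_left π γ (hπ hr j hj))
    (PartitionDiagram.glue_right π γ (hγ hr j hj))

/-- The partition algebra `A_r(δ)`, as a subalgebra of `A_{2k}(δ)` with `k = ⌈r/2⌉`; it is all of
`A_{2k}(δ)` if `r = 2k`. -/
noncomputable def PartitionAlgebra {K : Type*} [Field K] (r : ℕ) (δ : K) :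
    Subalgebra K (DiagramAlgebra δ ((r + 1) / 2)) :=
  (Submodule.span K (DiagramAlgebra.diagram δ '' {π | IsDiagramOf r π})).toSubalgebra
    (Submodule.subset_span ⟨PartitionDiagram.one _, fun _ _ _ => rfl, rfl⟩)
    (fun a b ha hb => by
      have h := Submodule.mul_mem_mul ha hb
      rw [Submodule.span_mul_span] at h
      refine Submodule.span_le.2 ?_ h
      rintro _ ⟨_, ⟨π, hπ, rfl⟩, _, ⟨γ, hγ, rfl⟩, rfl⟩
      show DiagramAlgebra.diagram δ π * DiagramAlgebra.diagram δ γ ∈ _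
      rw [DiagramAlgebra.diagram_mul_diagram]
      exact Submodule.smul_mem _ _ (Submodule.subset_span ⟨_, IsDiagramOf.comp hπ hγ, rfl⟩))

/-!
The proof compares the partition algebra with its action on tensor space. For a natural number
`n` the algebra `A_{2k}(n)` acts on functions of `k` labels in `Fin n` (`rep`), and this action is
faithful as soon as `n ≥ 2k` (`rep_injective`). All elements in the theorem have coefficients that
are polynomial functions of the parameter `δ` (`IsPolynomialFamily`), so an identity that holds on
tensor space for all large `n` holds for every `δ ∈ K`. In particular no semisimplicity of the
algebra itself is needed.

On tensor space Enyang's recursion has a closed solution (`isModel_jmData`): in zero-based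
positions `j`, the element `L_{2j+2}` sums over the labels `b` the transposition of `b` with the
label at position `j`, applied to the positions `0, …, j`; the element `L_{2j+1}` is `n` minus the
same sum with the transpositions applied to the positions `0, …, j - 1` only; and `σ_{2j+2}`,
`σ_{2j+3}` apply the transposition of the labels at positions `j` and `j + 1` to an initial segment
of positions. Commutativity of the `N_i` and their membership in `A_r(δ)` are then visible.

For centrality, power sums come first. A polynomial in the sum of the transpositions involving a
label `a` differs from one fixed element `z` of the group algebra of the symmetric group by an
element that fixes `a` (`exists_sub_aeval_starSum_mem`; here `z` is a power sum of Jucys–Murphy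
elements of the symmetric group). This makes the supersymmetric power sums of the `N_i` telescope to
an operator coming from the symmetric group on the labels, which commutes with all diagrams
(`commute_sum_aeval_jmTerm`).

A general supersymmetric polynomial is reduced to power sums through eigenvalues, without a
description of generators of the ring of supersymmetric polynomials. The `N_i` act by rational
symmetric matrices and are therefore simultaneously diagonalizable. If the supersymmetric power
sums agree at two points, so does every supersymmetric polynomial, because after cancelling pairs
`y, -y` the points differ by a parity-preserving permutation
(`IsSupersymmetric.eval_eq_of_signedSum_eq`). Hence an operator commuting with the power sums of the
`N_i` preserves the eigenspaces of `p(N_1, …, N_r)` and commutes with it (`commute_of_eval_eq`).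
-/

/-! ### Tensor space representation -/

namespace PartitionDiagram

/-- The number of extensions of a labelling `g` of the points `f v` to a labelling of all points
that is constant on the blocks of `W`: every block that meets no point `f v` is labelled
freely. -/
theorem card_extensions {X O : Type*} [Finite X] (W : Setoid X) (f : O → X) {n : ℕ}
    (g : O → Fin n) (h : Setoid.comap f W ≤ Setoid.ker g) :
    Nat.card {F : X → Fin n // W ≤ Setoid.ker F ∧ F ∘ f = g} = n ^ hidden W f := by
  classical
  have e : Nat.card ({c : Quotient W // ∀ v : O, Quotient.mk W (f v) ≠ c} → Fin n) =
      n ^ hidden W f := by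
    rw [Nat.card_fun, Nat.card_eq_fintype_card, Fintype.card_fin]; rfl
  rw [← e]
  refine Nat.card_congr (Equiv.ofBijective
    (fun F c => Quotient.lift F.1 (fun _ _ hab => F.2.1 hab) c.1) ⟨?_, ?_⟩)
  · rintro ⟨F, hF, hFf⟩ ⟨F', hF', hFf'⟩ hh
    apply Subtype.ext
    funext x
    by_cases hx : ∃ v, Quotient.mk W (f v) = Quotient.mk W x
    · obtain ⟨v, hv⟩ := hx
      have hv := Quotient.exact hv
      have h1 : F (f v) = F x := hF hv
      have h2 : F' (f v) = F' x := hF' hv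
      have h3 := congrFun hFf v
      have h4 := congrFun hFf' v
      simp only [Function.comp] at h3 h4
      show F x = F' x
      rw [← h1, ← h2, h3, h4]
    · push Not at hx
      exact congrFun hh ⟨Quotient.mk W x, hx⟩
  · intro t
    have key : ∀ x v, W (f v) x → ∀ hx : ∃ v, Quotient.mk W (f v) = Quotient.mk W x,
        g hx.choose = g v := fun x v hv hx =>
      h (show W _ _ from W.trans (Quotient.exact hx.choose_spec) (W.symm hv))
    refine ⟨⟨fun x => if hx : ∃ v, Quotient.mk W (f v) = Quotient.mk W x then g hx.choose
      else t ⟨Quotient.mk W x, fun v hv => hx ⟨v, hv⟩⟩, ?_, ?_⟩, ?_⟩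
    · intro x y hxy
      have hq : Quotient.mk W x = Quotient.mk W y := Quotient.sound hxy
      simp only [Setoid.ker_def, hq]
    · funext v
      have hv : ∃ w, Quotient.mk W (f w) = Quotient.mk W (f v) := ⟨v, rfl⟩
      simp only [Function.comp, dif_pos hv]
      exact key _ v (W.refl _) hv
    · funext ⟨c, hc⟩
      induction c using Quotient.inductionOn with
      | _ x =>
        have hx : ¬ ∃ v, Quotient.mk W (f v) = Quotient.mk W x := fun ⟨v, hv⟩ => hc v hv
        simp only [Quotient.lift_mk, dif_neg hx]

/-- The labels `u` and `w` of the top and the bottom row agree on the blocks of `π`. -/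
def Compat {k n : ℕ} (π : PartitionDiagram k) (u w : Fin k → Fin n) : Prop :=
  π ≤ Setoid.ker fun v : Fin 2 × Fin k => ![u, w] v.1 v.2

theorem compat_one {k n : ℕ} (u w : Fin k → Fin n) : Compat (one k) u w ↔ u = w := by
  constructor
  · intro h
    funext j
    exact h (show one k (0, j) (1, j) from rfl)
  · rintro rfl ⟨a, i⟩ ⟨b, j⟩ h
    obtain rfl : i = j := h
    fin_cases a <;> fin_cases b <;> rfl

theorem glue_le_ker {k n : ℕ} (π γ : PartitionDiagram k) (u w x : Fin k → Fin n) :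
    glue π γ ≤ Setoid.ker (fun v : Fin 3 × Fin k => ![u, w, x] v.1 v.2) ↔
      Compat π u w ∧ Compat γ w x := by
  have h1 : ∀ v : Fin 2 × Fin k, ![u, w] v.1 v.2 =
      ![u, w, x] (rows k ![(0 : Fin 3), 1] v).1 (rows k ![(0 : Fin 3), 1] v).2 := by
    rintro ⟨a, i⟩; fin_cases a <;> rfl
  have h2 : ∀ v : Fin 2 × Fin k, ![w, x] v.1 v.2 =
      ![u, w, x] (rows k ![(1 : Fin 3), 2] v).1 (rows k ![(1 : Fin 3), 2] v).2 := by
    rintro ⟨a, i⟩; fin_cases a <;> rfl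
  constructor
  · intro h
    constructor
    · intro a b hab
      rw [Setoid.ker_def, h1, h1]
      exact h (glue_left π γ hab)
    · intro a b hab
      rw [Setoid.ker_def, h2, h2]
      exact h (glue_right π γ hab)
  · rintro ⟨hπ, hγ⟩
    refine sup_le (map_le fun a b hab => ?_) (map_le fun a b hab => ?_)
    · rw [Setoid.ker_def, ← h1, ← h1]
      exact hπ hab
    · rw [Setoid.ker_def, ← h2, ← h2]
      exact hγ hab

open Classical in
/-- Summing over the labels of the middle row yields the factor `n ^ n(π, γ)` that the product in
the partition algebra with parameter `n` prescribes. -/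
theorem card_compat {k n : ℕ} (π γ : PartitionDiagram k) (u x : Fin k → Fin n) :
    Nat.card {w // Compat π u w ∧ Compat γ w x} =
      if Compat (comp π γ) u x then n ^ removed π γ else 0 := by
  have hux : ∀ (w : Fin k → Fin n) (v : Fin 2 × Fin k),
      ![u, w, x] (rows k ![(0 : Fin 3), 2] v).1 (rows k ![(0 : Fin 3), 2] v).2 =
        ![u, x] v.1 v.2 := by
    rintro w ⟨a, i⟩; fin_cases a <;> rfl
  split_ifs with h
  · rw [removed, ← card_extensions (glue π γ) (rows k ![0, 2])
      (fun v => ![u, x] v.1 v.2) h]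
    refine Nat.card_congr (Equiv.ofBijective
      (fun w => ⟨fun v => ![u, w.1, x] v.1 v.2,
        (glue_le_ker π γ u w.1 x).2 w.2, funext (hux w.1)⟩) ⟨?_, ?_⟩)
    · rintro ⟨w, hw⟩ ⟨w', hw'⟩ hh
      apply Subtype.ext
      funext j
      exact congrFun (congrArg Subtype.val hh) (1, j)
    · rintro ⟨F, hF, hFf⟩
      have hF' : (fun v : Fin 3 × Fin k => ![u, fun j => F (1, j), x] v.1 v.2) = F := by
        funext ⟨a, j⟩
        have h0 := congrFun hFf (0, j)
        have h1 := congrFun hFf (1, j)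
        fin_cases a
        · exact h0.symm
        · rfl
        · exact h1.symm
      refine ⟨⟨fun j => F (1, j), ?_⟩, Subtype.ext hF'⟩
      rw [← glue_le_ker, hF']
      exact hF
  · rw [Nat.card_eq_zero]
    refine Or.inl ⟨fun w => h ?_⟩
    intro a b hab
    have h3 := (glue_le_ker π γ u w.1 x).2 w.2 hab
    rw [Setoid.ker_def, hux, hux] at h3
    exact h3

instance (k : ℕ) : Finite (PartitionDiagram k) :=
  Finite.of_injective (fun (π : PartitionDiagram k) a b => π a b)
    (fun π γ h => Setoid.ext fun a b => by rw [show π a b = γ a b from congrFun (congrFun h a) b])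

noncomputable instance (k : ℕ) : Fintype (PartitionDiagram k) := Fintype.ofFinite _

end PartitionDiagram

namespace DiagramAlgebra

open PartitionDiagram

variable {K : Type*} [Field K] {k n : ℕ}

open Classical in
/-- The operator of a diagram on functions of `k` labels in `Fin n`: its matrix entry at `(u, w)`
is `1` if the labels `u`, `w` of the two rows are constant on blocks, and `0` otherwise. -/
noncomputable def diagramOp (K : Type*) [Field K] {k : ℕ} (n : ℕ) (π : PartitionDiagram k) :
    Module.End K ((Fin k → Fin n) → K) :=
  Matrix.toLin' (Matrix.of fun u w => if Compat π u w then 1 else 0)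

open Classical in
theorem diagramOp_apply (π : PartitionDiagram k) (f : (Fin k → Fin n) → K) (u : Fin k → Fin n) :
    diagramOp K n π f u = ∑ w, if Compat π u w then f w else 0 := by
  simp [diagramOp, Matrix.toLin'_apply, Matrix.mulVec, dotProduct]

open Classical in
theorem diagramOp_mul (π γ : PartitionDiagram k) :
    diagramOp K n π * diagramOp K n γ =
      (n : K) ^ removed π γ • diagramOp K n (comp π γ) := by
  unfold diagramOp
  rw [Module.End.mul_eq_comp, ← Matrix.toLin'_mul, ← map_smul]
  congr 1
  ext u x
  have h := card_compat π γ u x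
  rw [Nat.card_eq_fintype_card, Fintype.card_subtype] at h
  have h' := congrArg (Nat.cast : ℕ → K) h
  simp only [Matrix.mul_apply, Matrix.of_apply, Matrix.smul_apply, smul_eq_mul, mul_ite, mul_one,
    mul_zero, ← ite_and]
  rw [Finset.card_filter] at h'
  push_cast at h'
  rw [← h']
  refine Finset.sum_congr rfl fun w _ => ?_
  simp only [and_comm]

theorem diagramOp_one : diagramOp K n (one k) = 1 := by
  classical
  ext1
  ext u
  simp [diagramOp_apply, compat_one]

/-- The partition algebra with parameter `n` acts on functions of `k` labels in `Fin n`. -/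
noncomputable def rep (K : Type*) [Field K] (n k : ℕ) :
    DiagramAlgebra (n : K) k →ₐ[K] Module.End K ((Fin k → Fin n) → K) :=
  AlgHom.ofLinearMap ((basis (n : K) k).constr K (diagramOp K n))
    (by rw [one_def, ← basis_apply, Module.Basis.constr_basis, diagramOp_one])
    (fun a b => by
      have h : (mulBilin (n : K) k).compr₂ ((basis (n : K) k).constr K (diagramOp K n)) =
          (LinearMap.mul K (Module.End K ((Fin k → Fin n) → K))).compl₁₂
            ((basis (n : K) k).constr K (diagramOp K n))
            ((basis (n : K) k).constr K (diagramOp K n)) := by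
        refine (basis (n : K) k).ext fun π => (basis (n : K) k).ext fun γ => ?_
        rw [LinearMap.compr₂_apply, LinearMap.compl₁₂_apply, ← mul_def, LinearMap.mul_apply',
          Module.Basis.constr_basis, Module.Basis.constr_basis, basis_apply, basis_apply,
          diagram_mul_diagram, map_smul, ← basis_apply, Module.Basis.constr_basis, diagramOp_mul]
      exact LinearMap.congr_fun (LinearMap.congr_fun h a) b)

theorem rep_diagram (π : PartitionDiagram k) : rep K n k (diagram _ π) = diagramOp K n π := by
  rw [← basis_apply]
  exact Module.Basis.constr_basis (basis (n : K) k) K (diagramOp K n) π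

open Classical in
theorem rep_apply_single (a : DiagramAlgebra (n : K) k) (u w : Fin k → Fin n) :
    rep K n k a (Pi.single w 1) u =
      ∑ π : PartitionDiagram k, if Compat π u w then (basis _ k).repr a π else 0 := by
  conv_lhs => rw [← (basis (n : K) k).sum_repr a]
  simp only [map_sum, map_smul, LinearMap.sum_apply, LinearMap.smul_apply, Finset.sum_apply,
    Pi.smul_apply, smul_eq_mul, basis_apply, rep_diagram, diagramOp_apply, Pi.single_apply]
  refine Finset.sum_congr rfl fun π _ => ?_
  rw [Finset.sum_eq_single w (fun b _ hb => by simp [hb]) (by simp)]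
  simp

theorem exists_ker_eq (hn : 2 * k ≤ n) (π : PartitionDiagram k) :
    ∃ u w : Fin k → Fin n, Setoid.ker (fun v : Fin 2 × Fin k => ![u, w] v.1 v.2) = π := by
  classical
  have hc : Fintype.card (Quotient π) ≤ Fintype.card (Fin n) := by
    refine (Fintype.card_le_of_surjective _ (Quotient.mk_surjective (s := π))).trans ?_
    simpa using hn
  obtain ⟨ι⟩ := Function.Embedding.nonempty_of_card_le hc
  refine ⟨fun j => ι (Quotient.mk π (0, j)), fun j => ι (Quotient.mk π (1, j)), ?_⟩
  have : (fun v : Fin 2 × Fin k => ![fun j => ι (Quotient.mk π (0, j)),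
      fun j => ι (Quotient.mk π (1, j))] v.1 v.2) = fun v => ι (Quotient.mk π v) := by
    funext ⟨a, j⟩
    fin_cases a <;> rfl
  rw [this]
  ext a b
  rw [Setoid.ker_def, ι.injective.eq_iff]
  exact Quotient.eq

/-- For `n ≥ 2k` every diagram is the kernel of a pair of labellings, and the matrix entry of `a`
there is the sum of the coefficients of `a` over the finer diagrams. The coefficients on a class
of diagrams closed under refinement can thus be recovered recursively. -/
theorem repr_eq_zero_of_rep (hn : 2 * k ≤ n) (a : DiagramAlgebra (n : K) k)
    (P : PartitionDiagram k → Prop) (hP : ∀ π γ, π ≤ γ → P γ → P π)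
    (h : ∀ u w : Fin k → Fin n, P (Setoid.ker fun v : Fin 2 × Fin k => ![u, w] v.1 v.2) →
      rep K n k a (Pi.single w 1) u = 0) (π : PartitionDiagram k) (hπ : P π) :
    (basis _ k).repr a π = 0 := by
  classical
  induction π using WellFoundedLT.induction with
  | _ π ih =>
    obtain ⟨u, w, huw⟩ := exists_ker_eq hn π
    have h1 := h u w (huw ▸ hπ)
    rw [rep_apply_single, Finset.sum_eq_single π] at h1
    · rwa [if_pos] at h1
      exact huw.ge
    · intro γ _ hγ
      split_ifs with hc
      · have hle : γ ≤ π := huw ▸ hc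
        exact ih γ (lt_of_le_of_ne hle hγ) (hP _ _ hle hπ)
      · rfl
    · simp

theorem rep_injective (hn : 2 * k ≤ n) : Function.Injective (rep K n k) := by
  rw [injective_iff_map_eq_zero]
  intro a ha
  refine (basis (n : K) k).ext_elem fun π => ?_
  rw [map_zero, Finsupp.zero_apply]
  exact repr_eq_zero_of_rep hn a (fun _ => True) (fun _ _ _ _ => trivial)
    (fun u w _ => by rw [ha]; rfl) π trivial

end DiagramAlgebra

/-! ### The Jucys–Murphy elements on tensor space -/

namespace DiagramAlgebra

open PartitionDiagram Equiv

variable {K : Type*} [Field K] {k n : ℕ}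

/-- The permutation `g` of the labels applied to the first `c` positions. -/
def act (g : Perm (Fin n)) (c : ℕ) (u : Fin k → Fin n) : Fin k → Fin n :=
  fun j => if j.val < c then g (u j) else u j

/-- The operator summing over all labels `b`, the label at position `j` included, the
transposition of `b` with the label at position `j`, applied to the first `c` positions. It is used
for `c = j` and `c = j + 1`. -/
def jmOp (R : Type*) [CommRing R] (c : ℕ) (j : Fin k) : Module.End R ((Fin k → Fin n) → R) where
  toFun f u := ∑ b, f (act (swap (u j) b) c u)
  map_add' f g := by funext u; simp [Finset.sum_add_distrib]
  map_smul' a f := by funext u; simp [Finset.mul_sum]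

/-- The operator applying the transposition of the labels at positions `i` and `j` to the first
`c` positions. -/
def transpOp (R : Type*) [CommRing R] (c : ℕ) (i j : Fin k) :
    Module.End R ((Fin k → Fin n) → R) where
  toFun f u := f (act (swap (u i) (u j)) c u)
  map_add' f g := by funext u; simp
  map_smul' a f := by funext u; simp

theorem jmOp_apply {R : Type*} [CommRing R] (c : ℕ) (j : Fin k) (f : (Fin k → Fin n) → R)
    (u : Fin k → Fin n) : jmOp R c j f u = ∑ b, f (act (swap (u j) b) c u) := rfl

theorem transpOp_apply {R : Type*} [CommRing R] (c : ℕ) (i j : Fin k) (f : (Fin k → Fin n) → R)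
    (u : Fin k → Fin n) : transpOp R c i j f u = f (act (swap (u i) (u j)) c u) := rfl

theorem rep_s {m : ℕ} (hm : m + 1 < k) (f : (Fin k → Fin n) → K) (u : Fin k → Fin n) :
    rep K n k (s _ k (m + 1)) f u =
      f (u ∘ swap (⟨m, by omega⟩ : Fin k) ⟨m + 1, hm⟩) := by
  classical
  set τ := swap (⟨m, by omega⟩ : Fin k) ⟨m + 1, hm⟩ with hτ
  have hval : ∀ j : Fin k, swap (m + 1) (m + 1 + 1) (j.val + 1) = (τ j).val + 1 := by
    intro j
    rw [hτ, swap_apply_def, swap_apply_def]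
    simp only [Fin.ext_iff]
    split_ifs <;> simp_all
  have hlab : (fun v : Fin 2 × Fin k => if v.1 = 0 then v.2.val + 1
      else swap (m + 1) (m + 1 + 1) (v.2.val + 1)) =
      fun v => (if v.1 = 0 then v.2 else τ v.2).val + 1 := by
    funext v
    split_ifs
    · rfl
    · exact hval _
  rw [s, rep_diagram, diagramOp_apply, hlab]
  have : ∀ w : Fin k → Fin n, Compat (Setoid.ker fun v : Fin 2 × Fin k =>
      (if v.1 = 0 then v.2 else τ v.2).val + 1) u w ↔ w = u ∘ τ := by
    intro w
    constructor
    · intro h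
      funext j
      exact (h (x := (0, τ j)) (y := (1, j)) rfl).symm
    · rintro rfl ⟨a, i⟩ ⟨b, j⟩ h
      have h' : (if a = 0 then i else τ i) = if b = 0 then j else τ j :=
        Fin.ext (Nat.succ_injective h)
      have := congrArg u h'
      fin_cases a <;> fin_cases b <;> exact this
  simp [this]

theorem rep_eEven {m : ℕ} (hm : m + 1 < k) (f : (Fin k → Fin n) → K) (u : Fin k → Fin n) :
    rep K n k (e _ k (2 * m + 2)) f u =
      if u ⟨m, by omega⟩ = u ⟨m + 1, hm⟩ then f u else 0 := by
  classical
  have he : e (n : K) k (2 * m + 2) = eEven (n : K) k (m + 1) := by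
    rw [e, if_pos ⟨m + 1, by ring⟩]
    congr 1
    omega
  rw [he, eEven, rep_diagram, diagramOp_apply]
  have : ∀ w : Fin k → Fin n, Compat (Setoid.ker fun v : Fin 2 × Fin k =>
      if v.2.val + 1 = m + 1 + 1 then m + 1 else v.2.val + 1) u w ↔
        w = u ∧ u ⟨m, by omega⟩ = u ⟨m + 1, hm⟩ := by
    intro w
    constructor
    · intro h
      refine ⟨funext fun j => (h (x := (0, j)) (y := (1, j)) rfl).symm,
        h (x := (0, _)) (y := (0, _)) ?_⟩
      simp [Setoid.ker_def]
    · rintro ⟨rfl, hu⟩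
      have key : ∀ i j : Fin k, (if i.val + 1 = m + 1 + 1 then m + 1 else i.val + 1) =
          (if j.val + 1 = m + 1 + 1 then m + 1 else j.val + 1) → w i = w j := by
        intro i j hij
        split_ifs at hij with h1 h2 h2
        · exact congrArg w (Fin.ext (by omega))
        · rw [show i = ⟨m + 1, hm⟩ from Fin.ext (by simpa using h1),
            show j = ⟨m, by omega⟩ from Fin.ext (by simp; omega), hu]
        · rw [show j = ⟨m + 1, hm⟩ from Fin.ext (by simpa using h2),
            show i = ⟨m, by omega⟩ from Fin.ext (by simp; omega), hu]
        · exact congrArg w (Fin.ext (by omega))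
      rintro ⟨a, i⟩ ⟨b, j⟩ h
      have := key i j h
      fin_cases a <;> fin_cases b <;> exact this
  simp only [this]
  rw [Finset.sum_eq_single u (fun w _ hw => by simp [hw]) (by simp)]
  simp

theorem rep_eOdd {m : ℕ} (hm : m < k) (f : (Fin k → Fin n) → K) (u : Fin k → Fin n) :
    rep K n k (e _ k (2 * m + 1)) f u = ∑ b, f (Function.update u ⟨m, hm⟩ b) := by
  classical
  have he : e (n : K) k (2 * m + 1) = eOdd (n : K) k (m + 1) := by
    rw [e, if_neg (by simp [parity_simps])]
    congr 1
    omega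
  rw [he, eOdd, rep_diagram, diagramOp_apply]
  have : ∀ w : Fin k → Fin n, Compat (Setoid.ker fun v : Fin 2 × Fin k =>
      (v.2.val + 1, if v.2.val + 1 = m + 1 then v.1 else 0)) u w ↔
        w ∈ Set.range (Function.update u ⟨m, hm⟩) := by
    intro w
    constructor
    · intro h
      refine ⟨w ⟨m, hm⟩, funext fun j => ?_⟩
      by_cases hj : j = ⟨m, hm⟩
      · rw [hj, Function.update_self]
      · rw [Function.update_of_ne hj]
        refine h (x := (0, j)) (y := (1, j)) ?_
        have : j.val ≠ m := fun h => hj (Fin.ext h)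
        simp [Setoid.ker_def, this]
    · rintro ⟨b, rfl⟩ ⟨a, i⟩ ⟨c, j⟩ h
      simp only [Setoid.ker_def, Prod.mk.injEq, Nat.add_right_cancel_iff] at h
      obtain ⟨h1, h2⟩ := h
      obtain rfl : i = j := Fin.ext h1
      by_cases hi : i.val = m
      · rw [if_pos hi, if_pos hi] at h2
        rw [h2]
      · have : i ≠ ⟨m, hm⟩ := fun h => hi (congrArg Fin.val h)
        fin_cases a <;> fin_cases c <;> simp [Function.update_of_ne this]
  simp only [this]
  rw [← Finset.sum_filter, ← Finset.sum_image (s := Finset.univ) (f := f)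
    (g := Function.update u ⟨m, hm⟩) (Function.update_injective _ _).injOn]
  refine Finset.sum_congr ?_ fun _ _ => rfl
  ext w
  simp

/-- The labelling `u` with `g` applied before position `m` and with the labels `x`, `y`, `z` at
the positions `m`, `m + 1`, `m + 2` (as far as these exist). -/
def point (m : ℕ) (u : Fin k → Fin n) (g : Perm (Fin n)) (x y z : Fin n) : Fin k → Fin n :=
  fun j => if j.val < m then g (u j) else if j.val = m then x else if j.val = m + 1 then y
    else if j.val = m + 2 then z else u j

theorem exists_point_eq (m : ℕ) (u : Fin k → Fin n) (hm : m < k) :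
    ∃ x y z, point m u 1 x y z = u := by
  refine ⟨u ⟨m, hm⟩, if h : m + 1 < k then u ⟨m + 1, h⟩ else u ⟨m, hm⟩,
    if h : m + 2 < k then u ⟨m + 2, h⟩ else u ⟨m, hm⟩, ?_⟩
  funext j
  have hj := j.isLt
  unfold point
  split_ifs
  all_goals first
    | rfl
    | exact congrArg u (Fin.ext (by simp_all))

variable {m : ℕ} (u : Fin k → Fin n) (g : Perm (Fin n)) (x y z : Fin n)

theorem point_zero (hm : m < k) : point m u g x y z ⟨m, hm⟩ = x := by simp [point]

theorem point_one (hm : m + 1 < k) : point m u g x y z ⟨m + 1, hm⟩ = y := by simp [point]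

theorem point_two (hm : m + 2 < k) : point m u g x y z ⟨m + 2, hm⟩ = z := by simp [point]

theorem act_point_zero (h : Perm (Fin n)) :
    act h m (point m u g x y z) = point m u (h * g) x y z := by
  funext j
  simp only [act, point]
  split_ifs <;> simp_all

theorem act_point_one (h : Perm (Fin n)) :
    act h (m + 1) (point m u g x y z) = point m u (h * g) (h x) y z := by
  funext j
  simp only [act, point]
  split_ifs <;> first | rfl | omega

theorem act_point_two (h : Perm (Fin n)) :
    act h (m + 2) (point m u g x y z) = point m u (h * g) (h x) (h y) z := by
  funext j
  simp only [act, point]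
  split_ifs <;> first | rfl | omega

theorem act_point_three (h : Perm (Fin n)) :
    act h (m + 3) (point m u g x y z) = point m u (h * g) (h x) (h y) (h z) := by
  funext j
  simp only [act, point]
  split_ifs <;> first | rfl | omega

variable (f : (Fin k → Fin n) → K)

theorem rep_s_point (hm : m + 1 < k) : rep K n k (s _ k (m + 1)) f (point m u g x y z) =
    f (point m u g y x z) := by
  rw [rep_s hm]
  congr 1
  funext j
  simp only [Function.comp, point, swap_apply_def, Fin.ext_iff]
  split_ifs <;> simp_all

theorem rep_s_point' (hm : m + 2 < k) : rep K n k (s _ k (m + 2)) f (point m u g x y z) =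
    f (point m u g x z y) := by
  rw [rep_s (m := m + 1) hm]
  congr 1
  funext j
  by_cases h1 : j = ⟨m + 1, Nat.lt_of_succ_lt hm⟩
  · subst h1
    simp [point, show ¬ m + 1 + 1 < m by omega, show m + 1 + 1 ≠ m by omega]
  by_cases h2 : j = ⟨m + 2, hm⟩
  · subst h2
    simp [point]
  rw [Function.comp, swap_apply_of_ne_of_ne h1 h2]
  simp only [Fin.ext_iff] at h1 h2
  simp [point, h1, h2]

theorem rep_eEven_point (hm : m + 1 < k) :
    rep K n k (e _ k (2 * m + 2)) f (point m u g x y z) =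
      if x = y then f (point m u g x y z) else 0 := by
  rw [rep_eEven hm, point_zero, point_one]

theorem rep_eEven_point' (hm : m + 2 < k) :
    rep K n k (e _ k (2 * m + 4)) f (point m u g x y z) =
      if y = z then f (point m u g x y z) else 0 := by
  rw [show 2 * m + 4 = 2 * (m + 1) + 2 by ring, rep_eEven (m := m + 1) hm, point_one, point_two]

theorem rep_eOdd_point (hm : m + 1 < k) :
    rep K n k (e _ k (2 * m + 3)) f (point m u g x y z) =
      ∑ c, f (point m u g x c z) := by
  rw [show 2 * m + 3 = 2 * (m + 1) + 1 by ring, rep_eOdd (m := m + 1) hm]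
  refine Finset.sum_congr rfl fun c _ => congrArg f (funext fun j => ?_)
  simp only [Function.update_apply, point, Fin.ext_iff]
  split_ifs <;> first | rfl | omega

/-- The predicted action of the elements `L_{2m+1}`, `L_{2m+2}`, `σ_{2m+2}`, `σ_{2m+3}` on tensor
space. The bounds say that these elements lie in `A_{2k}`; beyond them the generators in the
recursion have no meaning. -/
structure IsModel (K : Type*) [Field K] (k n m : ℕ) (D : JMData (DiagramAlgebra (n : K) k)) :
    Prop where
  Lodd : ∀ hm : m < k, rep K n k D.Lodd = (n : K) • 1 - jmOp K m ⟨m, hm⟩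
  Leven : ∀ hm : m < k, rep K n k D.Leven = jmOp K (m + 1) ⟨m, hm⟩
  σeven : ∀ hm : m + 1 < k, rep K n k D.σeven = transpOp K m ⟨m, by omega⟩ ⟨m + 1, hm⟩
  σodd : ∀ hm : m + 1 < k, rep K n k D.σodd = transpOp K (m + 2) ⟨m, by omega⟩ ⟨m + 1, hm⟩

/-- Two sums that differ in a single summand. -/
theorem sum_eq_sum_add_sub {ι : Type*} [Fintype ι] [DecidableEq ι] {A B : ι → K} (i : ι)
    (h : ∀ j, j ≠ i → A j = B j) : ∑ j, A j = ∑ j, B j + (A i - B i) := by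
  rw [← Finset.add_sum_erase _ A (Finset.mem_univ i),
    ← Finset.add_sum_erase _ B (Finset.mem_univ i),
    Finset.sum_congr rfl fun j hj => h j (Finset.ne_of_mem_erase hj)]
  ring

theorem isModel_jmData_zero (K : Type*) [Field K] (k n : ℕ) :
    IsModel K k n 0 (jmData (n : K) k 0) := by
  refine ⟨fun hm => ?_, fun hm => ?_, fun hm => ?_, fun hm => ?_⟩
  · refine LinearMap.ext fun f => funext fun u => ?_
    have : ∀ g : Perm (Fin n), act g 0 u = u := fun g => by funext j; simp [act]
    simp [jmData, jmOp_apply, this]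
  · refine LinearMap.ext fun f => funext fun u => ?_
    rw [jmData, jmOp_apply]
    refine (rep_eOdd (m := 0) hm f u).trans ?_
    refine Finset.sum_congr rfl fun c _ => congrArg f (funext fun j => ?_)
    simp only [Function.update_apply, act, Fin.ext_iff]
    split_ifs with h1 h2 h2
    · rw [show j = ⟨0, hm⟩ from Fin.ext h1, swap_apply_left]
    · omega
    · omega
    · rfl
  · refine LinearMap.ext fun f => funext fun u => ?_
    simp only [jmData, map_one, transpOp_apply, Module.End.one_apply]
    congr 1
  · refine LinearMap.ext fun f => funext fun u => ?_
    obtain ⟨x, y, z, hu⟩ := exists_point_eq 0 u (by omega)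
    rw [← hu, jmData, transpOp_apply, point_zero, point_one, act_point_two]
    refine (rep_s_point (m := 0) u 1 x y z f hm).trans ?_
    rw [swap_apply_left, swap_apply_right]
    congr 1

/-- Both sides are evaluated at an arbitrary labelling, written as `point m u g x y z`: the
generators and the operators of the recursion only change `g`, `x`, `y`, `z`, so that an identity
between sums of values of one function of these four arguments remains. -/
theorem rep_Lodd_succ (hD : IsModel K k n m (jmData (n : K) k m))
    (hm : m + 1 < k) :
    rep K n k (jmData (n : K) k (m + 1)).Lodd = (n : K) • 1 - jmOp K (m + 1) ⟨m + 1, hm⟩ := by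
  refine LinearMap.ext fun f => funext fun u => ?_
  obtain ⟨x, y, z, hu⟩ := exists_point_eq m u (by omega)
  rw [← hu]
  generalize (1 : Perm (Fin n)) = g
  simp only [jmData, map_add, map_sub, map_mul, Module.End.mul_apply, LinearMap.add_apply,
    LinearMap.sub_apply, Pi.add_apply, Pi.sub_apply, jmOp_apply, transpOp_apply,
    swap_apply_left, Finset.sum_ite_eq', Finset.mem_univ, if_true,
    hD.Lodd (by omega), hD.Leven (by omega), hD.σeven hm, rep_s_point _ _ _ _ _ _ hm,
    rep_eEven_point _ _ _ _ _ _ hm, point_zero, point_one, act_point_zero, act_point_one,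
    AlgHom.commutes, Module.algebraMap_end_apply, LinearMap.smul_apply, Module.End.one_apply,
    Pi.smul_apply, smul_eq_mul]
  generalize hF : (fun g x y z => f (point m u g x y z)) = F
  have hF' : ∀ g x y z, f (point m u g x y z) = F g x y z := fun g x y z => by rw [← hF]
  simp only [hF']
  -- For `x ≠ y` the two sums differ only in the summand with label `x`, where the terms with `e`
  -- and `σ` account for the difference.
  by_cases hxy : x = y
  · subst hxy
    simp only [if_true, swap_self, swap_apply_left]
    ring
  · rw [sum_eq_sum_add_sub (A := fun b => F (swap y b * g) (swap y b x) y z)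
      (B := fun b => F (swap y b * g) x y z) x
      fun b hb => by rw [swap_apply_of_ne_of_ne hxy hb.symm]]
    simp only [hxy, if_false, swap_apply_right, swap_comm x y, Finset.sum_const_zero]
    ring

theorem rep_Leven_succ (hD : IsModel K k n m (jmData (n : K) k m))
    (hm : m + 1 < k) : rep K n k (jmData (n : K) k (m + 1)).Leven = jmOp K (m + 2) ⟨m + 1, hm⟩ := by
  refine LinearMap.ext fun f => funext fun u => ?_
  obtain ⟨x, y, z, hu⟩ := exists_point_eq m u (by omega)
  rw [← hu]
  generalize (1 : Perm (Fin n)) = g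
  simp only [jmData, map_add, map_sub, map_mul, Module.End.mul_apply, LinearMap.add_apply,
    LinearMap.sub_apply, Pi.add_apply, Pi.sub_apply, jmOp_apply, transpOp_apply,
    swap_apply_left, swap_apply_right, Finset.sum_ite_eq, Finset.sum_ite_eq', Finset.mem_univ,
    if_true, hD.Leven (by omega), hD.σodd hm, rep_s_point _ _ _ _ _ _ hm,
    rep_eEven_point _ _ _ _ _ _ hm, rep_eOdd_point _ _ _ _ _ _ hm, point_zero, point_one,
    act_point_one, act_point_two]
  generalize hF : (fun g x y z => f (point m u g x y z)) = F
  have hF' : ∀ g x y z, f (point m u g x y z) = F g x y z := fun g x y z => by rw [← hF]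
  simp only [hF']
  -- For `x ≠ y` the two sums differ only in the summand with label `x`, where the terms with `e`
  -- and `σ` account for the difference.
  by_cases hxy : x = y
  · subst hxy
    simp only [if_true, swap_self, swap_apply_left]
    ring
  · rw [sum_eq_sum_add_sub (A := fun b => F (swap y b * g) (swap y b x) b z)
      (B := fun b => F (swap y b * g) x b z) x
      fun b hb => by rw [swap_apply_of_ne_of_ne hxy hb.symm]]
    simp only [hxy, if_false, swap_apply_right, swap_comm x y]
    ring

theorem rep_σeven_succ (hD : IsModel K k n m (jmData (n : K) k m))
    (hm : m + 2 < k) : rep K n k (jmData (n : K) k (m + 1)).σeven = 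
    transpOp K (m + 1) ⟨m + 1, Nat.lt_of_succ_lt hm⟩ ⟨m + 2, hm⟩ := by
  refine LinearMap.ext fun f => funext fun u => ?_
  obtain ⟨x, y, z, hu⟩ := exists_point_eq m u (by omega)
  rw [← hu]
  generalize (1 : Perm (Fin n)) = g
  simp only [jmData, map_add, map_sub, map_mul, Module.End.mul_apply, LinearMap.add_apply,
    LinearMap.sub_apply, Pi.add_apply, Pi.sub_apply, jmOp_apply, transpOp_apply,
    swap_apply_left, Finset.sum_ite_eq, Finset.sum_ite_eq', Finset.mem_univ,
    if_true, hD.Leven (by omega), hD.σeven (Nat.lt_of_succ_lt hm),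
    rep_s_point _ _ _ _ _ _ (Nat.lt_of_succ_lt hm), rep_s_point' _ _ _ _ _ _ hm,
    rep_eEven_point _ _ _ _ _ _ (Nat.lt_of_succ_lt hm), rep_eEven_point' _ _ _ _ _ _ hm,
    rep_eOdd_point _ _ _ _ _ _ (Nat.lt_of_succ_lt hm), point_zero, point_one, point_two,
    act_point_zero, act_point_one]
  generalize hF : (fun g x y z => f (point m u g x y z)) = F
  have hF' : ∀ g x y z, f (point m u g x y z) = F g x y z := fun g x y z => by rw [← hF]
  simp only [hF']
  by_cases hxy : x = y
  · subst hxy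
    by_cases hxz : x = z
    · subst hxz
      simp
    · simp [hxz]
  · by_cases hxz : x = z
    · subst hxz
      simp [hxy, swap_comm y x]
    · simp [hxy, hxz, swap_apply_of_ne_of_ne hxy hxz]

theorem rep_σodd_succ (hD : IsModel K k n m (jmData (n : K) k m))
    (hm : m + 2 < k) : rep K n k (jmData (n : K) k (m + 1)).σodd = 
    transpOp K (m + 3) ⟨m + 1, Nat.lt_of_succ_lt hm⟩ ⟨m + 2, hm⟩ := by
  refine LinearMap.ext fun f => funext fun u => ?_
  obtain ⟨x, y, z, hu⟩ := exists_point_eq m u (by omega)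
  rw [← hu]
  generalize (1 : Perm (Fin n)) = g
  simp only [jmData, map_add, map_sub, map_mul, Module.End.mul_apply, LinearMap.add_apply,
    LinearMap.sub_apply, Pi.add_apply, Pi.sub_apply, jmOp_apply, transpOp_apply,
    swap_apply_left, swap_apply_right, Finset.sum_ite_eq, Finset.sum_ite_eq', Finset.mem_univ,
    if_true, hD.Leven (by omega), hD.σodd (Nat.lt_of_succ_lt hm),
    rep_s_point _ _ _ _ _ _ (Nat.lt_of_succ_lt hm), rep_s_point' _ _ _ _ _ _ hm,
    rep_eEven_point _ _ _ _ _ _ (Nat.lt_of_succ_lt hm), rep_eEven_point' _ _ _ _ _ _ hm,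
    rep_eOdd_point _ _ _ _ _ _ (Nat.lt_of_succ_lt hm), point_zero, point_one, point_two,
    act_point_one, act_point_two, act_point_three]
  generalize hF : (fun g x y z => f (point m u g x y z)) = F
  have hF' : ∀ g x y z, f (point m u g x y z) = F g x y z := fun g x y z => by rw [← hF]
  simp only [hF']
  by_cases hxy : x = y
  · subst hxy
    by_cases hxz : x = z
    · subst hxz
      simp
    · simp [hxz, swap_comm z x]
  · by_cases hxz : x = z
    · subst hxz
      simp [hxy, swap_comm y x]
    · simp [hxy, hxz, swap_apply_of_ne_of_ne hxy hxz]

theorem isModel_jmData (K : Type*) [Field K] (k n : ℕ) (m : ℕ) :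
    IsModel K k n m (jmData (n : K) k m) := by
  induction m with
  | zero => exact isModel_jmData_zero K k n
  | succ m ih => exact ⟨rep_Lodd_succ ih, rep_Leven_succ ih, rep_σeven_succ ih, rep_σodd_succ ih⟩

end DiagramAlgebra

/-! ### Jucys–Murphy elements of the symmetric group -/

section SymmetricGroup

open Equiv

variable {K : Type*} [Field K]

theorem commute_pow_add_pow {A : Type*} [Ring A] {s x y : A} (hs : s * s = 1)
    (h : s * x = y * s - 1) (hxy : Commute x y) (m : ℕ) : Commute s (x ^ m + y ^ m) := by
  have h' : s * y = x * s + 1 := by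
    have : s * (s * x) * s = s * (y * s - 1) * s := by rw [h]
    rw [← mul_assoc, hs, one_mul, mul_sub, mul_one, sub_mul, hs] at this
    rw [this, mul_assoc, mul_assoc y, hs, mul_one, sub_add_cancel]
  have h1 : Commute s (x + y) := by
    rw [Commute, SemiconjBy, mul_add, h, h', add_mul]
    abel
  have h2 : Commute s (x * y) := by
    rw [Commute, SemiconjBy, ← mul_assoc, h, sub_mul, one_mul, mul_assoc y, h', mul_add, mul_one,
      add_sub_cancel_right, ← mul_assoc, hxy.eq]
  induction m using Nat.twoStepInduction with
  | zero => simp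
  | one => simpa using h1
  | more m ih1 ih2 =>
    have : x ^ (m + 2) + y ^ (m + 2) =
        (x + y) * (x ^ (m + 1) + y ^ (m + 1)) - x * y * (x ^ m + y ^ m) := by
      have hx : x * y * x ^ m = y * x ^ (m + 1) := by
        rw [hxy.eq, mul_assoc, ← pow_succ']
      have hy : x * y * y ^ m = x * y ^ (m + 1) := by
        rw [mul_assoc, ← pow_succ']
      rw [mul_add, mul_add, add_mul, add_mul, hx, hy, ← pow_succ', ← pow_succ']
      abel
    rw [this]
    exact (h1.mul_right ih2).sub_right (h2.mul_right ih1)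

/-- The sum of all transpositions that involve `a`, plus the identity. -/
noncomputable def starSum (K : Type*) [Field K] {n : ℕ} (a : Fin n) :
    MonoidAlgebra K (Perm (Fin n)) :=
  ∑ b, MonoidAlgebra.of K _ (swap a b)

/-- The Jucys–Murphy element of the symmetric group for the letter `i`, plus the identity. -/
noncomputable def jucysMurphy (K : Type*) [Field K] {n : ℕ} (i : Fin n) :
    MonoidAlgebra K (Perm (Fin n)) :=
  ∑ l ∈ Finset.Iic i, MonoidAlgebra.of K _ (swap l i)

theorem commute_jucysMurphy {n : ℕ} {g : Perm (Fin n)} {i : Fin n} (hi : g i = i)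
    (hg : ∀ l, l ≤ i ↔ g l ≤ i) : Commute (MonoidAlgebra.of K _ g) (jucysMurphy K i) := by
  rw [Commute, SemiconjBy, jucysMurphy, Finset.mul_sum, Finset.sum_mul]
  refine Finset.sum_equiv g (fun l => by simpa using hg l) fun l _ => ?_
  rw [← map_mul, ← map_mul]
  congr 1
  conv_rhs => rw [← hi, Equiv.swap_apply_apply]
  group

theorem of_swap_mul_jucysMurphy {n : ℕ} (i : Fin n) :
    MonoidAlgebra.of K _ (swap i.castSucc i.succ) * jucysMurphy K i.castSucc =
      jucysMurphy K i.succ * MonoidAlgebra.of K _ (swap i.castSucc i.succ) - 1 := by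
  have h1 : Finset.Iic i.succ = insert i.succ (Finset.Iic i.castSucc) := by
    ext l
    simp only [Finset.mem_Iic, Finset.mem_insert, Fin.le_def, Fin.ext_iff, Fin.val_succ,
      Fin.val_castSucc]
    omega
  have h2 : Finset.Iic i.castSucc = insert i.castSucc (Finset.Iio i.castSucc) := by
    ext l
    simp [le_iff_eq_or_lt]
  have h3 : i.succ ∉ Finset.Iic i.castSucc := by simp
  have h4 : i.castSucc ∉ Finset.Iio i.castSucc := by simp
  rw [jucysMurphy, jucysMurphy, h1, Finset.sum_insert h3, h2, Finset.sum_insert h4,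
    Finset.sum_insert h4, swap_self, swap_self]
  simp only [mul_add, add_mul, ← Equiv.Perm.one_def, map_one, one_mul, mul_one, ← map_mul,
    Equiv.swap_mul_self]
  rw [add_sub_assoc, add_sub_cancel_left, Finset.mul_sum, Finset.sum_mul]
  congr 1
  refine Finset.sum_congr rfl fun l hl => ?_
  rw [← map_mul, ← map_mul]
  congr 1
  have hl : l < i.castSucc := by simpa using hl
  have hl1 : l ≠ i.castSucc := hl.ne
  have hl2 : l ≠ i.succ := (hl.trans (Fin.castSucc_lt_succ)).ne
  have := Equiv.swap_apply_apply (swap i.castSucc i.succ) l i.castSucc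
  rw [swap_apply_left, swap_apply_of_ne_of_ne hl1 hl2] at this
  rw [this]
  group

theorem of_commute_sum_jucysMurphy_pow {n : ℕ} (m : ℕ) (g : Perm (Fin (n + 1))) :
    Commute (MonoidAlgebra.of K _ g) (∑ i, jucysMurphy K i ^ m) := by
  have hg : g ∈ Submonoid.closure (Set.range fun i : Fin n => swap i.castSucc i.succ) := by
    rw [Equiv.Perm.mclosure_swap_castSucc_succ]
    trivial
  induction hg using Submonoid.closure_induction with
  | one => rw [map_one]; exact Commute.one_left _
  | mul x y _ _ hx hy => rw [map_mul]; exact hx.mul_left hy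
  | mem x hx =>
    obtain ⟨i, rfl⟩ := hx
    have hne : i.castSucc ≠ i.succ := (Fin.castSucc_lt_succ).ne
    rw [← Finset.sum_add_sum_compl {i.castSucc, i.succ}, Finset.sum_pair hne]
    refine Commute.add_right ?_ (Commute.sum_right _ _ _ fun j hj => Commute.pow_right ?_ m)
    · refine commute_pow_add_pow ?_ (of_swap_mul_jucysMurphy i) ?_ m
      · rw [← map_mul, swap_mul_self, map_one]
      · rw [jucysMurphy]
        refine Commute.sum_left _ _ _ fun l hl => ?_
        have hl : l ≤ i.castSucc := by simpa using hl
        have hl' : l < i.succ := hl.trans_lt Fin.castSucc_lt_succ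
        refine commute_jucysMurphy (swap_apply_of_ne_of_ne hl'.ne' hne.symm) fun t => ?_
        rw [swap_apply_def]
        split_ifs with h1 h2
        · rw [h1]; exact iff_of_true hl'.le Fin.castSucc_lt_succ.le
        · rw [h2]; exact iff_of_true Fin.castSucc_lt_succ.le hl'.le
        · rfl
    · simp only [Finset.mem_compl, Finset.mem_insert, Finset.mem_singleton, not_or] at hj
      refine commute_jucysMurphy (swap_apply_of_ne_of_ne hj.1 hj.2) fun t => ?_
      obtain ⟨hj1, hj2⟩ := hj
      simp only [Fin.ext_iff, Fin.val_succ, Fin.val_castSucc] at hj1 hj2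
      rw [swap_apply_def]
      split_ifs with h1 h2
      · rw [h1, Fin.le_def, Fin.le_def, Fin.val_succ, Fin.val_castSucc]; omega
      · rw [h2, Fin.le_def, Fin.le_def, Fin.val_succ, Fin.val_castSucc]; omega
      · rfl

/-- The group algebra of the stabilizer of `a`. -/
noncomputable def stabAlgebra (K : Type*) [Field K] {n : ℕ} (a : Fin n) :
    Subalgebra K (MonoidAlgebra K (Perm (Fin n))) :=
  Algebra.adjoin K (MonoidAlgebra.of K _ '' {g | g a = a})

theorem conj_mem_stabAlgebra {n : ℕ} {a : Fin n} (g : Perm (Fin n))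
    {w : MonoidAlgebra K (Perm (Fin n))} (hw : w ∈ stabAlgebra K a) :
    MonoidAlgebra.of K _ g * w * MonoidAlgebra.of K _ g⁻¹ ∈ stabAlgebra K (g a) := by
  have hg : MonoidAlgebra.of K _ g⁻¹ * MonoidAlgebra.of K _ g = 1 := by
    rw [← map_mul, inv_mul_cancel, map_one]
  have hg' : MonoidAlgebra.of K _ g * MonoidAlgebra.of K _ g⁻¹ = 1 := by
    rw [← map_mul, mul_inv_cancel, map_one]
  induction hw using Algebra.adjoin_induction with
  | mem x hx =>
    obtain ⟨h, hh, rfl⟩ := hx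
    have hh : h a = a := hh
    rw [← map_mul, ← map_mul]
    exact Algebra.subset_adjoin ⟨_, by simp [hh], rfl⟩
  | algebraMap c =>
    rw [← Algebra.commutes, mul_assoc, hg', mul_one]
    exact Subalgebra.algebraMap_mem _ c
  | add x y _ _ hx hy => rw [mul_add, add_mul]; exact add_mem hx hy
  | mul x y _ _ hx hy =>
    have : MonoidAlgebra.of K _ g * (x * y) * MonoidAlgebra.of K _ g⁻¹ =
        (MonoidAlgebra.of K _ g * x * MonoidAlgebra.of K _ g⁻¹) *
          (MonoidAlgebra.of K _ g * y * MonoidAlgebra.of K _ g⁻¹) := by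
      simp only [mul_assoc]
      rw [← mul_assoc (MonoidAlgebra.of K _ g⁻¹) (MonoidAlgebra.of K _ g), hg, one_mul]
    rw [this]
    exact mul_mem hx hy

theorem of_mul_starSum {n : ℕ} (g : Perm (Fin n)) (a : Fin n) :
    MonoidAlgebra.of K _ g * starSum K a = starSum K (g a) * MonoidAlgebra.of K _ g := by
  rw [starSum, starSum, Finset.mul_sum, Finset.sum_mul]
  refine Finset.sum_equiv g (by simp) fun l _ => ?_
  rw [← map_mul, ← map_mul, Equiv.swap_apply_apply]
  congr 1
  group

/-- A polynomial in `starSum a` depends on `a` only up to elements of the group algebra of the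
stabilizer of `a`: power sums of Jucys–Murphy elements are central, and removing the last summand
from the power sum leaves an element that fixes the last letter. -/
theorem exists_sub_aeval_starSum_mem {n : ℕ} (q : Polynomial K) :
    ∃ z : MonoidAlgebra K (Perm (Fin n)), ∀ a, z - Polynomial.aeval (starSum K a) q ∈
      stabAlgebra K a := by
  obtain _ | n := n
  · exact ⟨0, fun a => a.elim0⟩
  induction q using Polynomial.induction_on' with
  | add p q hp hq =>
    obtain ⟨z, hz⟩ := hp
    obtain ⟨w, hw⟩ := hq
    refine ⟨z + w, fun a => ?_⟩
    rw [map_add, add_sub_add_comm]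
    exact add_mem (hz a) (hw a)
  | monomial m c =>
    refine ⟨c • ∑ i, jucysMurphy K i ^ m, fun a => ?_⟩
    rw [Polynomial.aeval_monomial, ← Algebra.smul_def, ← smul_sub]
    refine Subalgebra.smul_mem _ ?_ c
    have hlast : starSum K (Fin.last n) = jucysMurphy K (Fin.last n) := by
      rw [starSum, jucysMurphy]
      refine Finset.sum_congr ?_ fun l _ => by rw [swap_comm]
      ext l
      simp [Fin.le_last]
    have h0 : ∑ i, jucysMurphy K i ^ m - starSum K (Fin.last n) ^ m ∈
        stabAlgebra K (Fin.last n) := by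
      rw [hlast, Fin.sum_univ_castSucc, add_sub_cancel_right]
      refine sum_mem fun i _ => pow_mem (sum_mem fun l hl => ?_) m
      have hl : l ≤ i.castSucc := by simpa using hl
      have hi : i.castSucc < Fin.last n := Fin.castSucc_lt_last i
      exact Algebra.subset_adjoin
        ⟨_, swap_apply_of_ne_of_ne (hl.trans_lt hi).ne' hi.ne', rfl⟩
    set g := swap (Fin.last n) a
    have h1 := conj_mem_stabAlgebra g h0
    have hg : MonoidAlgebra.of K _ g * MonoidAlgebra.of K _ g⁻¹ = 1 := by
      rw [← map_mul, mul_inv_cancel, map_one]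
    have hpow : MonoidAlgebra.of K _ g * starSum K (Fin.last n) ^ m =
        starSum K a ^ m * MonoidAlgebra.of K _ g := by
      have : SemiconjBy (MonoidAlgebra.of K _ g) (starSum K (Fin.last n)) (starSum K a) := by
        have := of_mul_starSum (K := K) g (Fin.last n)
        rwa [swap_apply_left] at this
      exact this.pow_right m
    rwa [mul_sub, sub_mul, (of_commute_sum_jucysMurphy_pow m g).eq, hpow, mul_assoc, hg, mul_one,
      mul_assoc, hg, mul_one, swap_apply_left] at h1

end SymmetricGroup

/-! ### Centrality of power sums on tensor space -/

namespace DiagramAlgebra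

open PartitionDiagram Equiv Polynomial

variable {K : Type*} [Field K] {k n : ℕ}

theorem act_mul (g h : Perm (Fin n)) (c : ℕ) (u : Fin k → Fin n) :
    act (g * h) c u = act g c (act h c u) := by
  funext j
  simp only [act]
  split_ifs <;> rfl

theorem act_one (c : ℕ) (u : Fin k → Fin n) : act 1 c u = u := by
  funext j
  simp [act]

theorem act_of_le (g : Perm (Fin n)) {c : ℕ} (u : Fin k → Fin n) {j : Fin k} (h : c ≤ j.val) :
    act g c u j = u j := if_neg (by omega)

theorem act_of_lt (g : Perm (Fin n)) {c : ℕ} (u : Fin k → Fin n) {j : Fin k} (h : j.val < c) :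
    act g c u j = g (u j) := if_pos h

/-- Acting on a longer initial segment conjugates the action on a shorter one. -/
theorem act_act (g h : Perm (Fin n)) {c c' : ℕ} (hc : c' ≤ c) (u : Fin k → Fin n) :
    act g c (act h c' u) = act (g * h * g⁻¹) c' (act g c u) := by
  funext j
  simp only [act]
  split_ifs <;> first | omega | simp

/-- The symmetric group on the labels acting through the first `c` positions. -/
def actOp (K : Type*) [Field K] (k n c : ℕ) :
    Perm (Fin n) →* Module.End K ((Fin k → Fin n) → K) where
  toFun g :=
    { toFun := fun f u => f (act g⁻¹ c u)
      map_add' := fun _ _ => rfl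
      map_smul' := fun _ _ => rfl }
  map_one' := by
    refine LinearMap.ext fun f => funext fun u => ?_
    simp [act_one]
  map_mul' g h := by
    refine LinearMap.ext fun f => funext fun u => ?_
    simp [act_mul]

theorem actOp_apply (c : ℕ) (g : Perm (Fin n)) (f : (Fin k → Fin n) → K) (u : Fin k → Fin n) :
    actOp K k n c g f u = f (act g⁻¹ c u) := rfl

/-- The linear extension of `actOp` to the group algebra. -/
noncomputable def actAlg (K : Type*) [Field K] (k n c : ℕ) :
    MonoidAlgebra K (Perm (Fin n)) →ₐ[K] Module.End K ((Fin k → Fin n) → K) :=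
  MonoidAlgebra.lift K _ (Perm (Fin n)) (actOp K k n c)

theorem actAlg_of (c : ℕ) (g : Perm (Fin n)) :
    actAlg K k n c (MonoidAlgebra.of K _ g) = actOp K k n c g := by
  rw [actAlg, MonoidAlgebra.lift_of]

theorem commute_actAlg {c : ℕ} {x : Module.End K ((Fin k → Fin n) → K)}
    (hx : ∀ g, Commute x (actOp K k n c g)) (w : MonoidAlgebra K (Perm (Fin n))) :
    Commute x (actAlg K k n c w) := by
  induction w using MonoidAlgebra.induction_on with
  | of g => rw [actAlg_of]; exact hx g
  | add a b ha hb => rw [map_add]; exact ha.add_right hb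
  | smul r a ha => rw [map_smul]; exact ha.smul_right r

/-- The projection onto the functions supported where the label at position `j` is `a`. -/
def labelOp (K : Type*) [Field K] {k n : ℕ} (j : Fin k) (a : Fin n) :
    Module.End K ((Fin k → Fin n) → K) where
  toFun f u := if u j = a then f u else 0
  map_add' f g := by
    funext u
    simp only [Pi.add_apply]
    split_ifs <;> simp
  map_smul' c f := by funext u; simp

theorem labelOp_apply (j : Fin k) (a : Fin n) (f : (Fin k → Fin n) → K) (u : Fin k → Fin n) :
    labelOp K j a f u = if u j = a then f u else 0 := rfl

theorem sum_labelOp (j : Fin k) : ∑ a : Fin n, labelOp K j a = 1 := by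
  refine LinearMap.ext fun f => funext fun u => ?_
  simp [LinearMap.sum_apply, labelOp_apply]

theorem eq_of_labelOp_mul (j : Fin k) {x y : Module.End K ((Fin k → Fin n) → K)}
    (h : ∀ a, labelOp K j a * x = labelOp K j a * y) : x = y := by
  rw [← one_mul x, ← one_mul y, ← sum_labelOp j, Finset.sum_mul, Finset.sum_mul]
  exact Finset.sum_congr rfl fun a _ => h a

theorem labelOp_commute_actOp {c : ℕ} {j : Fin k} (h : c ≤ j.val) (a : Fin n)
    (g : Perm (Fin n)) : Commute (labelOp K j a) (actOp K k n c g) := by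
  refine LinearMap.ext fun f => funext fun u => ?_
  simp only [Module.End.mul_apply, labelOp_apply, actOp_apply, act_of_le _ _ h]

theorem labelOp_mul_jmOp (c : ℕ) (j : Fin k) (a : Fin n) :
    labelOp K j a * jmOp K c j = labelOp K j a * actAlg K k n c (starSum K a) := by
  refine LinearMap.ext fun f => funext fun u => ?_
  simp only [Module.End.mul_apply, labelOp_apply, jmOp_apply, starSum, map_sum, actAlg_of,
    LinearMap.sum_apply, Finset.sum_apply, actOp_apply, swap_inv]
  split_ifs with h
  · rw [h]
  · rfl

theorem jmOp_eq (c : ℕ) (j : Fin k) : jmOp K c j =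
    ∑ a : Fin n, labelOp K j a * actAlg K k n c (starSum K a) := by
  rw [← one_mul (jmOp K c j), ← sum_labelOp j, Finset.sum_mul]
  exact Finset.sum_congr rfl fun a _ => labelOp_mul_jmOp c j a

theorem commute_jmOp {c : ℕ} {j : Fin k} {x : Module.End K ((Fin k → Fin n) → K)}
    (h1 : ∀ a, Commute x (labelOp K j a)) (h2 : ∀ g, Commute x (actOp K k n c g)) :
    Commute x (jmOp K c j) := by
  rw [jmOp_eq]
  exact Commute.sum_right _ _ _ fun a _ => (h1 a).mul_right (commute_actAlg h2 _)

theorem labelOp_commute_jmOp {c : ℕ} {i j : Fin k} (h : c ≤ i.val) (a : Fin n) :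
    Commute (labelOp K i a) (jmOp K c j) := by
  refine LinearMap.ext fun f => funext fun u => ?_
  simp only [Module.End.mul_apply, labelOp_apply, jmOp_apply, act_of_le _ _ h]
  split_ifs <;> simp

theorem actOp_commute_jmOp {c c' : ℕ} {j : Fin k} (hj : j.val < c) (hc : c' ≤ c)
    (g : Perm (Fin n)) : Commute (actOp K k n c g) (jmOp K c' j) := by
  refine LinearMap.ext fun f => funext fun u => ?_
  simp only [Module.End.mul_apply, actOp_apply, jmOp_apply, act_of_lt _ _ hj]
  refine Finset.sum_equiv g (by simp) fun b _ => ?_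
  rw [act_act _ _ hc, ← Equiv.swap_apply_apply]
  simp

/-- The operator by which `L_{i+1}` acts, up to sign and a scalar: for `i = 2j` it is
`jmOp j j`, for `i = 2j + 1` it is `jmOp (j + 1) j`. Out of range the value is `0`. -/
def jmTerm (K : Type*) [Field K] (k n i : ℕ) : Module.End K ((Fin k → Fin n) → K) :=
  if h : i / 2 < k then jmOp K ((i + 1) / 2) ⟨i / 2, h⟩ else 0

theorem commute_jmTerm_of_lt {i j : ℕ} (hij : i < j) :
    Commute (jmTerm K k n i) (jmTerm K k n j) := by
  unfold jmTerm
  split_ifs with hi hj hj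
  · refine commute_jmOp (fun a => (labelOp_commute_jmOp ?_ a).symm)
      fun g => (actOp_commute_jmOp ?_ ?_ g).symm
    · simp only; omega
    · simp only; omega
    · omega
  · exact Commute.zero_right _
  · exact Commute.zero_left _
  · exact Commute.zero_left _

theorem commute_jmTerm (i j : ℕ) : Commute (jmTerm K k n i) (jmTerm K k n j) := by
  rcases lt_trichotomy i j with h | rfl | h
  · exact commute_jmTerm_of_lt h
  · exact Commute.refl _
  · exact (commute_jmTerm_of_lt h).symm

theorem mul_aeval_of_mul_pow {A : Type*} [Ring A] [Algebra K A] {M x y : A}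
    (h : ∀ m : ℕ, M * x ^ m = M * y ^ m) (q : K[X]) : M * aeval x q = M * aeval y q := by
  induction q using Polynomial.induction_on' with
  | add p q hp hq => rw [map_add, map_add, mul_add, mul_add, hp, hq]
  | monomial m c =>
    rw [aeval_monomial, aeval_monomial, ← Algebra.smul_def, ← Algebra.smul_def, mul_smul_comm,
      mul_smul_comm, h]

/-- Here `jmOp` changes the label at position `j`; it is handled by commuting it with the symmetric
group acting through the first `j + 1` positions. -/
theorem labelOp_mul_aeval_jmOp_succ (j : Fin k) (a : Fin n) (q : K[X]) :
    labelOp K j a * aeval (jmOp K (j.val + 1) j) q =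
      labelOp K j a * actAlg K k n (j.val + 1) (aeval (starSum K a) q) := by
  rw [← Polynomial.aeval_algHom_apply]
  refine mul_aeval_of_mul_pow (fun m => ?_) q
  have hc : Commute (jmOp K (j.val + 1) j) (actAlg K k n (j.val + 1) (starSum K a)) :=
    commute_actAlg (fun g => (actOp_commute_jmOp (by omega) le_rfl g).symm) _
  induction m with
  | zero => rfl
  | succ m ih =>
    rw [pow_succ, ← mul_assoc, ih, mul_assoc, ← (hc.pow_right m).eq, ← mul_assoc,
      labelOp_mul_jmOp, mul_assoc, ← pow_succ']

theorem labelOp_mul_aeval_jmOp_self (j : Fin k) (a : Fin n) (q : K[X]) :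
    labelOp K j a * aeval (jmOp K j.val j) q =
      labelOp K j a * actAlg K k n j.val (aeval (starSum K a) q) := by
  rw [← Polynomial.aeval_algHom_apply]
  refine mul_aeval_of_mul_pow (fun m => ?_) q
  have hc : Commute (labelOp K j a) (actAlg K k n j.val (starSum K a)) :=
    commute_actAlg (fun g => labelOp_commute_actOp le_rfl a g) _
  induction m with
  | zero => rfl
  | succ m ih =>
    rw [pow_succ, ← mul_assoc, ih, (hc.pow_right m).eq, mul_assoc, labelOp_mul_jmOp, ← mul_assoc,
      ← (hc.pow_right m).eq, mul_assoc, ← pow_succ]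

/-- On the functions supported where position `j` carries the label `a`, an element fixing `a`
acts in the same way through the first `j + 1` positions and through the first `j` positions. -/
theorem labelOp_mul_actAlg_succ (j : Fin k) {a : Fin n} {w : MonoidAlgebra K (Perm (Fin n))}
    (hw : w ∈ stabAlgebra K a) : labelOp K j a * actAlg K k n (j.val + 1) w =
      labelOp K j a * actAlg K k n j.val w := by
  have hc : ∀ v, Commute (labelOp K j a) (actAlg K k n j.val v) :=
    commute_actAlg (fun g => labelOp_commute_actOp le_rfl a g)
  induction hw using Algebra.adjoin_induction with
  | mem x hx =>
    obtain ⟨g, hg, rfl⟩ := hx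
    have hg : g⁻¹ a = a := by rw [Equiv.Perm.inv_eq_iff_eq]; exact (show g a = a from hg).symm
    rw [actAlg_of, actAlg_of]
    refine LinearMap.ext fun f => funext fun u => ?_
    simp only [Module.End.mul_apply, labelOp_apply, actOp_apply]
    split_ifs with h
    · congr 1
      funext i
      simp only [act]
      split_ifs with h1 h2 h2
      · rfl
      · rw [show i = j from Fin.ext (by omega), h, hg]
      · omega
      · rfl
    · rfl
  | algebraMap c => rw [AlgHom.commutes, AlgHom.commutes]
  | add x y _ _ hx hy => rw [map_add, map_add, mul_add, mul_add, hx, hy]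
  | mul x y _ _ hx hy =>
    rw [map_mul, map_mul, ← mul_assoc, hx, (hc x).eq, mul_assoc, hy, ← mul_assoc, ← (hc x).eq,
      mul_assoc]

theorem aeval_jmOp_self {q : K[X]} {z : MonoidAlgebra K (Perm (Fin n))}
    (hz : ∀ a, z - aeval (starSum K a) q ∈ stabAlgebra K a) (j : Fin k) :
    actAlg K k n j.val z - aeval (jmOp K j.val j) q =
      ∑ a, labelOp K j a * actAlg K k n (j.val + 1) (z - aeval (starSum K a) q) := by
  rw [← one_mul (_ - _), ← sum_labelOp j, Finset.sum_mul]
  refine Finset.sum_congr rfl fun a _ => ?_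
  rw [labelOp_mul_actAlg_succ j (hz a), mul_sub, labelOp_mul_aeval_jmOp_self, ← mul_sub, map_sub]

theorem aeval_jmOp_succ_sub {q : K[X]} {z : MonoidAlgebra K (Perm (Fin n))}
    (hz : ∀ a, z - aeval (starSum K a) q ∈ stabAlgebra K a) (j : Fin k) :
    aeval (jmOp K (j.val + 1) j) q - aeval (jmOp K j.val j) q =
      actAlg K k n (j.val + 1) z - actAlg K k n j.val z := by
  refine eq_of_labelOp_mul j fun a => ?_
  have h := labelOp_mul_actAlg_succ j (hz a)
  rw [map_sub, map_sub, mul_sub, mul_sub] at h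
  rw [mul_sub, mul_sub, labelOp_mul_aeval_jmOp_succ, labelOp_mul_aeval_jmOp_self]
  rw [sub_eq_sub_iff_add_eq_add] at h ⊢
  rw [h, add_comm]

/-- The supersymmetric power sums telescope. -/
theorem sum_aeval_jmTerm {q : K[X]} {z : MonoidAlgebra K (Perm (Fin n))}
    (hz : ∀ a, z - aeval (starSum K a) q ∈ stabAlgebra K a) (t : ℕ) (ht : t ≤ k) :
    ∑ i ∈ Finset.range (2 * t),
        (if Even i then -aeval (jmTerm K k n i) q else aeval (jmTerm K k n i) q) =
      actAlg K k n t z - actAlg K k n 0 z := by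
  induction t with
  | zero => simp
  | succ t ih =>
    have h := aeval_jmOp_succ_sub hz (⟨t, ht⟩ : Fin k)
    have h0 : jmTerm K k n (2 * t) = jmOp K t ⟨t, ht⟩ := by
      rw [jmTerm, dif_pos (by omega)]
      congr
      all_goals omega
    have h1 : jmTerm K k n (2 * t + 1) = jmOp K (t + 1) ⟨t, ht⟩ := by
      rw [jmTerm, dif_pos (by omega)]
      congr
      all_goals omega
    rw [show 2 * (t + 1) = 2 * t + 1 + 1 by ring, Finset.sum_range_succ, Finset.sum_range_succ,
      ih (by omega), h0, h1, if_pos (even_two_mul t),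
      if_neg (by simp [parity_simps]), add_assoc, neg_add_eq_sub, h]
    abel

/-- An operator that commutes with the symmetric group on the labels, and for odd `r` also with
the projections at the last position, commutes with the supersymmetric power sums. -/
theorem commute_sum_aeval_jmTerm {r : ℕ} (hk : (r + 1) / 2 = k)
    {x : Module.End K ((Fin k → Fin n) → K)} (hx : ∀ g, Commute x (actOp K k n k g))
    (hx' : Odd r → ∀ j : Fin k, j.val + 1 = k → ∀ a, Commute x (labelOp K j a)) (q : K[X]) :
    Commute x (∑ i ∈ Finset.range r,
      (if Even i then -aeval (jmTerm K k n i) q else aeval (jmTerm K k n i) q)) := by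
  obtain ⟨z, hz⟩ := exists_sub_aeval_starSum_mem (n := n) q
  have h0 : Commute x (actAlg K k n 0 z) := by
    refine commute_actAlg (fun g => ?_) z
    have : actOp K k n 0 g = 1 := by
      refine LinearMap.ext fun f => funext fun u => ?_
      rw [actOp_apply, Module.End.one_apply]
      congr 1
    rw [this]
    exact Commute.one_right x
  rcases Nat.even_or_odd' r with ⟨t, rfl | rfl⟩
  · obtain rfl : t = k := by omega
    rw [sum_aeval_jmTerm hz t le_rfl]
    exact (commute_actAlg hx z).sub_right h0
  · obtain rfl : t + 1 = k := by omega
    have ht : jmTerm K (t + 1) n (2 * t) = jmOp K t ⟨t, by omega⟩ := by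
      rw [jmTerm, dif_pos (by omega)]
      congr
      all_goals omega
    rw [Finset.sum_range_succ, sum_aeval_jmTerm hz t (by omega), if_pos (even_two_mul t), ht,
      ← sub_eq_add_neg, sub_right_comm]
    have h := aeval_jmOp_self hz (⟨t, by omega⟩ : Fin (t + 1))
    simp only at h
    rw [h]
    exact (Commute.sum_right _ _ _ fun a _ =>
      (hx' ⟨t, rfl⟩ _ rfl a).mul_right (commute_actAlg hx _)).sub_right h0

theorem compat_act (g : Perm (Fin n)) (π : PartitionDiagram k) (u w : Fin k → Fin n) :
    Compat π (act g k u) (act g k w) ↔ Compat π u w := by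
  have h : ∀ v : Fin 2 × Fin k, ![act g k u, act g k w] v.1 v.2 = g (![u, w] v.1 v.2) := by
    rintro ⟨a, i⟩
    fin_cases a <;> exact act_of_lt g _ i.isLt
  constructor
  · intro hc a b hab
    have := hc hab
    rw [Setoid.ker_def, h, h] at this
    exact g.injective this
  · intro hc a b hab
    rw [Setoid.ker_def, h, h]
    exact congrArg g (hc hab)

theorem diagramOp_commute_actOp (π : PartitionDiagram k) (g : Perm (Fin n)) :
    Commute (diagramOp K n π) (actOp K k n k g) := by
  classical
  refine LinearMap.ext fun f => funext fun u => ?_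
  simp only [Module.End.mul_apply, actOp_apply, diagramOp_apply]
  refine Finset.sum_bij (fun w _ => act g⁻¹ k w) (by simp) (fun w _ w' _ h => ?_)
    (fun w _ => ⟨act g k w, Finset.mem_univ _, ?_⟩) fun w _ => ?_
  · have := congrArg (act g k) h
    rwa [← act_mul, ← act_mul, mul_inv_cancel, act_one, act_one] at this
  · rw [← act_mul, inv_mul_cancel, act_one]
  · simp only [compat_act]

theorem diagramOp_commute_labelOp {π : PartitionDiagram k} {j : Fin k} (h : π (0, j) (1, j))
    (a : Fin n) : Commute (diagramOp K n π) (labelOp K j a) := by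
  classical
  refine LinearMap.ext fun f => funext fun u => ?_
  simp only [Module.End.mul_apply, labelOp_apply, diagramOp_apply]
  split_ifs with hu
  · refine Finset.sum_congr rfl fun w _ => ?_
    split_ifs with h1 h2
    · rfl
    · exact absurd ((show u j = w j from h1 h).symm.trans hu) h2
    · rfl
  · refine Finset.sum_eq_zero fun w _ => ?_
    split_ifs with h1 h2
    · exact absurd ((show u j = w j from h1 h).trans h2) hu
    · rfl
    · rfl

end DiagramAlgebra

/-! ### Diagonalizable operators and joint eigenspaces -/

/-- A rational symmetric matrix is semisimple over every field of characteristic zero: a symmetric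
rational matrix of square zero vanishes, so that the minimal polynomial over the rationals is
squarefree. -/
theorem isSemisimple_toLin'_map_of_symm {K ι : Type*} [Field K] [CharZero K]
    [Fintype ι] [DecidableEq ι] (A : Matrix ι ι ℚ) (hA : A.transpose = A) :
    Module.End.IsSemisimple (Matrix.toLin' (A.map (algebraMap ℚ K))) := by
  have hsymm : ∀ q : Polynomial ℚ, (Polynomial.aeval A q).transpose = Polynomial.aeval A q := by
    intro q
    induction q using Polynomial.induction_on' with
    | add p q hp hq => rw [map_add, Matrix.transpose_add, hp, hq]
    | monomial m c =>
      rw [Polynomial.aeval_monomial, ← Algebra.smul_def, Matrix.transpose_smul,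
        Matrix.transpose_pow, hA]
  have hrad : IsRadical (minpoly ℚ A) := by
    rw [isRadical_iff_pow_one_lt 2 one_lt_two]
    intro q hq
    rw [minpoly.dvd_iff] at hq ⊢
    have h : (Polynomial.aeval A q).conjTranspose * Polynomial.aeval A q = 0 := by
      rw [Matrix.conjTranspose_eq_transpose_of_trivial, hsymm, ← pow_two, ← map_pow, hq]
    exact Matrix.conjTranspose_mul_self_eq_zero.1 h
  have hsq : Squarefree (minpoly ℚ A) :=
    hrad.squarefree (minpoly.ne_zero (Algebra.IsIntegral.isIntegral A))
  have hsq' : Squarefree ((minpoly ℚ A).map (algebraMap ℚ K)) :=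
    (PerfectField.separable_iff_squarefree.2 hsq).map.squarefree
  refine Module.End.isSemisimple_of_squarefree_aeval_eq_zero hsq' ?_
  have h1 : Polynomial.aeval (A.map (algebraMap ℚ K)) ((minpoly ℚ A).map (algebraMap ℚ K)) = 0 := by
    rw [Polynomial.aeval_map_algebraMap]
    have := Polynomial.aeval_algHom_apply (Algebra.ofId ℚ K).mapMatrix A (minpoly ℚ A)
    rw [minpoly.aeval, map_zero] at this
    exact this
  have h2 := Polynomial.aeval_algHom_apply (Matrix.toLinAlgEquiv' (R := K) (n := ι)).toAlgHom
    (A.map (algebraMap ℚ K)) ((minpoly ℚ A).map (algebraMap ℚ K))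
  rw [h1, map_zero] at h2
  exact h2

section JointEigenspaces

open MvPolynomial Module.End

variable {K V σ : Type*} [Field K] [AddCommGroup V] [Module K V]

theorem apply_of_mem_iInf_eigenspace (ψ : MvPolynomial σ K →ₐ[K] Module.End K V) {χ : σ → K}
    {v : V} (hv : v ∈ ⨅ i, (ψ (X i)).eigenspace (χ i)) (p : MvPolynomial σ K) :
    ψ p v = eval χ p • v := by
  induction p using MvPolynomial.induction_on with
  | C c =>
    rw [← algebraMap_eq, AlgHom.commutes, Module.algebraMap_end_apply, algebraMap_eq, eval_C]
  | add p q hp hq => rw [map_add, LinearMap.add_apply, hp, hq, map_add, add_smul]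
  | mul_X p i hp =>
    have hi : ψ (X i) v = χ i • v := mem_eigenspace_iff.1 ((Submodule.mem_iInf _).1 hv i)
    rw [map_mul, Module.End.mul_apply, hi, map_smul, hp, map_mul, eval_X, smul_smul, mul_comm]

/-- If the joint eigenvalue of `p` is determined by the joint eigenvalues of the elements of `T`,
then whatever commutes with the operators in `T` commutes with that of `p`. -/
theorem commute_of_eval_eq [IsAlgClosed K] [FiniteDimensional K V]
    (ψ : MvPolynomial σ K →ₐ[K] Module.End K V) (hss : ∀ i, (ψ (X i)).IsSemisimple)
    (T : Set (MvPolynomial σ K))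
    {x : Module.End K V} (hx : ∀ t ∈ T, Commute x (ψ t)) {p : MvPolynomial σ K}
    (hp : ∀ χ χ' : σ → K, (∀ t ∈ T, eval χ t = eval χ' t) → eval χ p = eval χ' p) :
    Commute x (ψ p) := by
  classical
  have htop : ⨆ χ : σ → K, ⨅ i, (ψ (X i)).eigenspace (χ i) = ⊤ := by
    have hcomm : ∀ i j, Commute (ψ (X i)) (ψ (X j)) := fun i j => by
      rw [Commute, SemiconjBy, ← map_mul, mul_comm, map_mul]
    simpa only [(hss _).isFinitelySemisimple.maxGenEigenspace_eq_eigenspace] using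
      iSup_iInf_maxGenEigenspace_eq_top_of_iSup_maxGenEigenspace_eq_top_of_commute
        (fun i => ψ (X i)) (fun i j _ => hcomm i j) fun i => iSup_maxGenEigenspace_eq_top _
  refine LinearMap.ext fun v => ?_
  have hv : v ∈ ⨆ χ : σ → K, ⨅ i, (ψ (X i)).eigenspace (χ i) := htop ▸ Submodule.mem_top
  induction hv using Submodule.iSup_induction' with
  | zero => rw [map_zero, map_zero]
  | add v w _ _ hv hw => rw [map_add, map_add, hv, hw]
  | mem χ v hv =>
    rw [Module.End.mul_apply, Module.End.mul_apply, apply_of_mem_iInf_eigenspace ψ hv, map_smul]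
    set w := x v with hw
    have hwT : ∀ t ∈ T, ψ t w = eval χ t • w := fun t ht => by
      rw [hw, ← Module.End.mul_apply, ← (hx t ht).eq, Module.End.mul_apply,
        apply_of_mem_iInf_eigenspace ψ hv, map_smul]
    obtain ⟨c, hc, hcw⟩ := (Submodule.mem_iSup_iff_exists_finsupp _ w).1
      (htop ▸ Submodule.mem_top : w ∈ ⨆ χ : σ → K, ⨅ i, (ψ (X i)).eigenspace (χ i))
    have hsep : ∀ χ' : σ → K, ∃ t : MvPolynomial σ K, eval χ p ≠ eval χ' p →
        t ∈ T ∧ eval χ t ≠ eval χ' t := by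
      intro χ'
      by_cases h : eval χ p = eval χ' p
      · exact ⟨0, fun h' => absurd h h'⟩
      · have := mt (hp χ χ') h
        push Not at this
        obtain ⟨t, ht, ht'⟩ := this
        exact ⟨t, fun _ => ⟨ht, ht'⟩⟩
    choose t ht using hsep
    -- `R` annihilates the components of `w` whose `p`-eigenvalue differs from the expected one,
    -- but acts on `w` by a non-zero scalar.
    set B := c.support.filter fun χ' => eval χ p ≠ eval χ' p with hB
    have hR : ∀ s ⊆ B, ∃ d : K, d ≠ 0 ∧
        ψ (∏ χ' ∈ s, (t χ' - C (eval χ' (t χ')))) w = d • w := by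
      intro s
      induction s using Finset.induction_on with
      | empty => exact fun _ => ⟨1, one_ne_zero, by simp⟩
      | insert χ' s hs ih =>
        intro hsub
        obtain ⟨d, hd, hdw⟩ := ih ((Finset.subset_insert _ _).trans hsub)
        have hmem := hsub (Finset.mem_insert_self _ _)
        rw [hB, Finset.mem_filter] at hmem
        obtain ⟨hT, hne⟩ := ht χ' hmem.2
        refine ⟨d * (eval χ (t χ') - eval χ' (t χ')), mul_ne_zero hd (sub_ne_zero.2 hne), ?_⟩
        rw [Finset.prod_insert hs, map_mul, Module.End.mul_apply, hdw, map_smul, map_sub,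
          LinearMap.sub_apply, hwT _ hT, ← algebraMap_eq, AlgHom.commutes,
          Module.algebraMap_end_apply, ← sub_smul, smul_smul]
    obtain ⟨d, hd, hdw⟩ := hR B subset_rfl
    set R := ∏ χ' ∈ B, (t χ' - C (eval χ' (t χ')))
    have h0 : ψ ((p - C (eval χ p)) * R) w = 0 := by
      rw [← hcw, Finsupp.sum, map_sum]
      refine Finset.sum_eq_zero fun χ' hχ' => ?_
      rw [apply_of_mem_iInf_eigenspace ψ (hc χ')]
      by_cases h : eval χ p = eval χ' p
      · simp [h]
      · have : eval χ' R = 0 := by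
          rw [map_prod]
          exact Finset.prod_eq_zero (i := χ') (Finset.mem_filter.2 ⟨hχ', h⟩) (by simp)
        rw [map_mul, this, mul_zero, zero_smul]
    rw [map_mul, Module.End.mul_apply, hdw, map_smul, smul_eq_zero_iff_right hd, map_sub,
      LinearMap.sub_apply, ← algebraMap_eq, AlgHom.commutes, Module.algebraMap_end_apply,
      sub_eq_zero] at h0
    exact h0.symm

end JointEigenspaces

/-! ### Values of supersymmetric polynomials -/

namespace IsSupersymmetric

open MvPolynomial Equiv

variable {K : Type*} [Field K] {r : ℕ} {p : MvPolynomial (Fin r) K}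

theorem rename_eq (hp : IsSupersymmetric p) (τ : Perm (Fin r))
    (hτ : ∀ i, Even (i.val) ↔ Even (τ i).val) : rename τ p = p := by
  set τ₀ := Perm.ofSubtype (τ.subtypePerm (p := fun i => Even i.val) fun i => (hτ i).symm)
  set τ₁ := Perm.ofSubtype (τ.subtypePerm (p := fun i => ¬ Even i.val)
    fun i => (not_congr (hτ i)).symm)
  have h : τ = τ₀ * τ₁ := by
    ext i
    congr 1
    rw [Perm.mul_apply]
    by_cases hi : Even i.val
    · rw [Perm.ofSubtype_apply_of_not_mem (p := fun i : Fin r => ¬ Even i.val) _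
        (by simpa using hi),
        Perm.ofSubtype_apply_of_mem (p := fun i : Fin r => Even i.val) _ hi]
      rfl
    · rw [Perm.ofSubtype_apply_of_mem (p := fun i : Fin r => ¬ Even i.val) _ hi,
        Perm.ofSubtype_apply_of_not_mem (p := fun i : Fin r => Even i.val)]
      · rfl
      · exact fun h => hi ((hτ i).2 h)
  have h0 : rename τ₀ p = p := hp.symm_odd τ₀ fun i hi =>
    Perm.ofSubtype_apply_of_not_mem (p := fun i : Fin r => Even i.val) _
      (by simpa [parity_simps] using hi)
  have h1 : rename τ₁ p = p := hp.symm_even τ₁ fun i hi =>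
    Perm.ofSubtype_apply_of_not_mem (p := fun i : Fin r => ¬ Even i.val) _
      (by simpa [parity_simps] using hi)
  have h2 : (τ : Fin r → Fin r) = τ₀ ∘ τ₁ := by rw [h]; rfl
  rw [h2, ← rename_rename, h1, h0]

theorem eval_comp (hp : IsSupersymmetric p) (χ : Fin r → K) (τ : Perm (Fin r))
    (hτ : ∀ i, Even (i.val) ↔ Even (τ i).val) : eval (χ ∘ τ) p = eval χ p := by
  rw [← eval_rename, hp.rename_eq τ hτ]

theorem eval_cancel_zero_one (hp : IsSupersymmetric p) (hr : 2 ≤ r) (χ : Fin r → K) (y y' : K) :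
    eval (fun i => if i.val + 1 = 1 then y else if i.val + 1 = 2 then -y else χ i) p =
      eval (fun i => if i.val + 1 = 1 then y' else if i.val + 1 = 2 then -y' else χ i) p := by
  obtain ⟨q, hq⟩ := hp.cancellation hr
  have key : ∀ y : K,
      eval (fun i => if i.val + 1 = 1 then y else if i.val + 1 = 2 then -y else χ i) p =
        eval χ q := by
    intro y
    have h := congrArg (Polynomial.eval₂RingHom (eval χ) y) hq
    rw [Polynomial.coe_eval₂RingHom, Polynomial.eval₂_C, ← Polynomial.coe_eval₂RingHom] at h
    rw [← h, ← RingHom.coe_coe (aeval _), ← RingHom.comp_apply]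
    congr 1
    refine MvPolynomial.ringHom_ext (fun c => ?_) fun i => ?_
    · simp
    · simp only [eval_X, RingHom.comp_apply, RingHom.coe_coe, aeval_X]
      split_ifs <;> simp
  rw [key y, key y']

theorem eval_cancel (hp : IsSupersymmetric p) (χ : Fin r → K) {i j : Fin r} (hi : Even i.val)
    (hj : ¬ Even j.val) (hij : χ i = -χ j) :
    eval (Function.update (Function.update χ i 0) j 0) p = eval χ p := by
  have hr : 2 ≤ r := by
    have := j.isLt
    rcases Nat.eq_zero_or_pos j.val with h | h
    · rw [h] at hj; simp at hj
    · omega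
  have hne : i ≠ j := fun h => hj (h ▸ hi)
  set a : Fin r := ⟨0, by omega⟩ with ha
  set b : Fin r := ⟨1, by omega⟩ with hb
  have hab : a ≠ b := by simp [a, b]
  have haj : a ≠ j := fun h => hj (by rw [← h]; simp [a])
  have hib : i ≠ b := fun h => by rw [h] at hi; simp [b] at hi
  set τ : Perm (Fin r) := swap a i * swap b j with hτ
  have hτa : τ a = i := by
    rw [hτ, Perm.mul_apply, swap_apply_of_ne_of_ne hab haj, swap_apply_left]
  have hτb : τ b = j := by
    rw [hτ, Perm.mul_apply, swap_apply_left, swap_apply_of_ne_of_ne haj.symm hne.symm]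
  have hpar : ∀ l, Even l.val ↔ Even (τ l).val := by
    have h0 : ∀ l, Even l.val ↔ Even (swap a i l).val := by
      intro l
      rw [swap_apply_def]
      split_ifs with h1 h2
      · rw [h1]; simp [a, hi]
      · rw [h2]; simp [a, hi]
      · rfl
    have h1 : ∀ l, Even l.val ↔ Even (swap b j l).val := by
      intro l
      rw [swap_apply_def]
      split_ifs with h1 h2
      · rw [h1]; simp [b, hj]
      · rw [h2]; simp [b, hj]
      · rfl
    intro l
    rw [hτ, Perm.mul_apply, ← h0, ← h1]
  rw [← hp.eval_comp _ τ hpar, ← hp.eval_comp χ τ hpar]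
  have h := hp.eval_cancel_zero_one hr (χ ∘ τ) 0 (χ i)
  have hv0 : ∀ l : Fin r, l.val + 1 = 1 ↔ l = a := fun l => by simp [a, Fin.ext_iff]
  have hv1 : ∀ l : Fin r, l.val + 1 = 2 ↔ l = b := fun l => by simp [b, Fin.ext_iff]
  convert h using 3
  · funext l
    simp only [hv0, hv1, Function.comp, Function.update_apply]
    simp only [← hτa, ← hτb, τ.injective.eq_iff]
    split_ifs <;> simp
  · funext l
    simp only [hv0, hv1, Function.comp]
    split_ifs with h1 h2
    · rw [h1, hτa]
    · rw [h2, hτb, hij, neg_neg]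
    · rfl

/-- The number of indices with value `a` that are even (`b = true`) or odd (`b = false`). -/
noncomputable def valueCount (χ : Fin r → K) (b : Bool) (a : K) : ℕ :=
  Nat.card {i : Fin r // (decide (Even i.val), χ i) = (b, a)}

theorem eval_eq_of_valueCount_eq (hp : IsSupersymmetric p) {χ χ' : Fin r → K}
    (h : ∀ b a, valueCount χ b a = valueCount χ' b a) : eval χ p = eval χ' p := by
  have e : ∀ c : Bool × K, Nonempty ({i : Fin r // (decide (Even i.val), χ i) = c} ≃
      {i : Fin r // (decide (Even i.val), χ' i) = c}) := fun c =>
    Finite.card_eq.1 (h c.1 c.2)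
  set τ : Perm (Fin r) := Equiv.ofFiberEquiv fun c => (e c).some
  have hτ : ∀ i, (decide (Even (τ i).val), χ' (τ i)) = (decide (Even i.val), χ i) :=
    Equiv.ofFiberEquiv_map fun c => (e c).some
  simp only [Prod.mk.injEq, decide_eq_decide] at hτ
  rw [← hp.eval_comp χ' τ fun i => (hτ i).1.symm]
  congr 2
  funext i
  exact (hτ i).2.symm

/-- The supersymmetric analogue at `χ` of the symmetric sum of a function `g`; for a power
`g = (· ^ m)` it is a supersymmetric power sum. The index `i` belongs to the variable `x_{i+1}`. -/
def signedSum (χ : Fin r → K) (g : K → K) : K :=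
  ∑ i, if Even i.val then -g (-χ i) else g (χ i)

theorem signedSum_update (χ : Fin r → K) {i j : Fin r} (hi : Even i.val)
    (hj : ¬ Even j.val) (hij : χ i = -χ j) (g : K → K) :
    signedSum (Function.update (Function.update χ i 0) j 0) g = signedSum χ g := by
  have hne : i ≠ j := fun h => hj (h ▸ hi)
  rw [signedSum, signedSum, ← Finset.sum_add_sum_compl {i, j}, ← Finset.sum_add_sum_compl {i, j},
    Finset.sum_pair hne, Finset.sum_pair hne]
  congr 1
  · simp [hi, hj, hij, hne]
  · refine Finset.sum_congr rfl fun l hl => ?_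
    simp only [Finset.mem_compl, Finset.mem_insert, Finset.mem_singleton, not_or] at hl
    rw [Function.update_of_ne hl.2, Function.update_of_ne hl.1]

open Classical in
theorem signedSum_indicator (χ : Fin r → K) (a : K) :
    signedSum χ (fun y => if y = a then 1 else 0) =
      (valueCount χ false a : K) - (valueCount χ true (-a) : K) := by
  simp only [valueCount, Nat.card_eq_fintype_card, Fintype.card_subtype, Finset.card_filter,
    Prod.mk.injEq, signedSum]
  push_cast
  rw [← Finset.sum_sub_distrib]
  refine Finset.sum_congr rfl fun i _ => ?_
  by_cases h : Even i.val
  · by_cases h' : χ i = -a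
    · simp [h, h']
    · have : ¬ -χ i = a := fun h'' => h' (by rw [← h'', neg_neg])
      simp [h, h', this]
  · simp [h]

theorem valueCount_zero_eq {χ χ' : Fin r → K} {b : Bool}
    (h : ∀ a, a ≠ 0 → valueCount χ b a = valueCount χ' b a) :
    valueCount χ b 0 = valueCount χ' b 0 := by
  classical
  set S : Finset K := insert 0 (Finset.univ.image χ ∪ Finset.univ.image χ')
  have key : ∀ ξ : Fin r → K, (∀ i, ξ i ∈ S) → ∑ a ∈ S, valueCount ξ b a =
      (Finset.univ.filter fun i : Fin r => decide (Even i.val) = b).card := by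
    intro ξ hξ
    rw [Finset.card_eq_sum_card_fiberwise (f := ξ) (t := S) fun i _ => hξ i]
    refine Finset.sum_congr rfl fun a _ => ?_
    rw [valueCount, Nat.card_eq_fintype_card, Fintype.card_subtype, Finset.filter_filter]
    simp only [Prod.mk.injEq]
  have h1 := key χ fun i => by simp [S]
  have h2 := key χ' fun i => by simp [S]
  rw [← h2, ← Finset.add_sum_erase S _ (Finset.mem_insert_self _ _),
    ← Finset.add_sum_erase S _ (Finset.mem_insert_self _ _),
    Finset.sum_congr rfl fun a ha => h a (Finset.ne_of_mem_erase ha)] at h1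
  exact Nat.add_right_cancel h1

theorem valueCount_eq_zero_or {χ : Fin r → K}
    (h : ∀ i j : Fin r, Even i.val → ¬ Even j.val → χ i = -χ j → χ i = 0) {a : K} (ha : a ≠ 0) :
    valueCount χ false a = 0 ∨ valueCount χ true (-a) = 0 := by
  by_contra! hc
  obtain ⟨h1, h2⟩ := hc
  rw [valueCount, Nat.card_ne_zero] at h1 h2
  obtain ⟨⟨j, hj⟩⟩ := h1.1
  obtain ⟨⟨i, hi⟩⟩ := h2.1
  simp only [Prod.mk.injEq, decide_eq_false_iff_not, decide_eq_true_eq] at hi hj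
  have := h i j hi.1 hj.1 (by rw [hi.2, hj.2])
  rw [hi.2] at this
  exact ha (neg_eq_zero.1 this)

theorem card_update_lt (χ : Fin r → K) {i : Fin r} (j : Fin r) (hi : χ i ≠ 0) :
    Nat.card {l // Function.update (Function.update χ i 0) j 0 l ≠ 0} <
      Nat.card {l // χ l ≠ 0} := by
  classical
  rw [Nat.card_eq_fintype_card, Nat.card_eq_fintype_card, Fintype.card_subtype,
    Fintype.card_subtype]
  refine Finset.card_lt_card (Finset.ssubset_iff_of_subset ?_ |>.2 ⟨i, by simpa using hi, ?_⟩)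
  · intro l hl
    simp only [Finset.mem_filter, Finset.mem_univ, true_and, Function.update_apply] at hl ⊢
    split_ifs at hl <;> simp_all
  · simp only [Finset.mem_filter, Finset.mem_univ, true_and, Function.update_apply]
    split_ifs <;> simp

/-- A supersymmetric polynomial takes the same value at two points that are not distinguished by
supersymmetric sums: after all cancellations, either point is determined by these sums up to
permutations preserving the parity of the indices. -/
theorem eval_eq_of_signedSum_eq [CharZero K] (hp : IsSupersymmetric p) (χ χ' : Fin r → K)
    (h : ∀ g, signedSum χ g = signedSum χ' g) : eval χ p = eval χ' p := by
  classical
  generalize hN : Nat.card {l // χ l ≠ 0} + Nat.card {l // χ' l ≠ 0} = N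
  induction N using Nat.strong_induction_on generalizing χ χ' with
  | _ N ih =>
    by_cases h1 : ∀ i j : Fin r, Even i.val → ¬ Even j.val → χ i = -χ j → χ i = 0
    · by_cases h2 : ∀ i j : Fin r, Even i.val → ¬ Even j.val → χ' i = -χ' j → χ' i = 0
      · have key : ∀ a, a ≠ 0 → valueCount χ false a = valueCount χ' false a ∧
            valueCount χ true (-a) = valueCount χ' true (-a) := by
          intro a ha
          have hs := h fun y => if y = a then 1 else 0
          rw [signedSum_indicator, signedSum_indicator, sub_eq_sub_iff_add_eq_add] at hs
          norm_cast at hs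
          have := valueCount_eq_zero_or h1 ha
          have := valueCount_eq_zero_or h2 ha
          omega
        refine hp.eval_eq_of_valueCount_eq fun b a => ?_
        have hb : ∀ a, a ≠ 0 → valueCount χ b a = valueCount χ' b a := by
          intro a ha
          cases b
          · exact (key a ha).1
          · simpa using (key (-a) (neg_ne_zero.2 ha)).2
        by_cases ha : a = 0
        · rw [ha]
          exact valueCount_zero_eq hb
        · exact hb a ha
      · push Not at h2
        obtain ⟨i, j, hi, hj, hij, h0⟩ := h2
        rw [← hp.eval_cancel χ' hi (by simpa using hj) hij]
        refine ih _ ?_ _ _ (fun g => ?_) rfl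
        · have := card_update_lt χ' j h0
          omega
        · rw [h, signedSum_update χ' hi (by simpa using hj) hij]
    · push Not at h1
      obtain ⟨i, j, hi, hj, hij, h0⟩ := h1
      rw [← hp.eval_cancel χ hi (by simpa using hj) hij]
      refine ih _ ?_ _ _ (fun g => ?_) rfl
      · have := card_update_lt χ j h0
        omega
      · rw [← h, signedSum_update χ hi (by simpa using hj) hij]

end IsSupersymmetric

/-! ### Families of elements depending polynomially on the parameter -/

namespace DiagramAlgebra

open PartitionDiagram

variable {K : Type*} [Field K] {k : ℕ}

/-- A family of elements of the partition algebras, indexed by the parameter `δ`, whose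
coefficients are polynomial functions of `δ`. -/
def IsPolynomialFamily (a : ∀ δ : K, DiagramAlgebra δ k) : Prop :=
  ∀ π, ∃ q : Polynomial K, ∀ δ, (basis δ k).repr (a δ) π = q.eval δ

namespace IsPolynomialFamily

variable {a b : ∀ δ : K, DiagramAlgebra δ k}

theorem diagram (π : PartitionDiagram k) : IsPolynomialFamily fun δ : K => diagram δ π := by
  classical
  intro γ
  refine ⟨Polynomial.C (if π = γ then 1 else 0), fun δ => ?_⟩
  beta_reduce
  rw [← basis_apply, Module.Basis.repr_self, Finsupp.single_apply, Polynomial.eval_C]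

theorem smul (q : Polynomial K) (ha : IsPolynomialFamily a) :
    IsPolynomialFamily fun δ => q.eval δ • a δ := by
  intro π
  obtain ⟨p, hp⟩ := ha π
  exact ⟨q * p, fun δ => by rw [map_smul, Finsupp.smul_apply, hp, Polynomial.eval_mul, smul_eq_mul]⟩

theorem algebraMap (q : Polynomial K) :
    IsPolynomialFamily fun δ => algebraMap K (DiagramAlgebra δ k) (q.eval δ) := by
  simp only [Algebra.algebraMap_eq_smul_one]
  exact (diagram (one k)).smul q

theorem add (ha : IsPolynomialFamily a) (hb : IsPolynomialFamily b) :
    IsPolynomialFamily fun δ => a δ + b δ := by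
  intro π
  obtain ⟨p, hp⟩ := ha π
  obtain ⟨q, hq⟩ := hb π
  exact ⟨p + q, fun δ => by rw [map_add, Finsupp.add_apply, hp, hq, Polynomial.eval_add]⟩

theorem sub (ha : IsPolynomialFamily a) (hb : IsPolynomialFamily b) :
    IsPolynomialFamily fun δ => a δ - b δ := by
  intro π
  obtain ⟨p, hp⟩ := ha π
  obtain ⟨q, hq⟩ := hb π
  exact ⟨p - q, fun δ => by rw [map_sub, Finsupp.sub_apply, hp, hq, Polynomial.eval_sub]⟩

theorem mul (ha : IsPolynomialFamily a) (hb : IsPolynomialFamily b) :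
    IsPolynomialFamily fun δ => a δ * b δ := by
  classical
  intro π
  choose p hp using ha
  choose q hq using hb
  refine ⟨∑ γ, ∑ ρ, p γ * q ρ * (Polynomial.X ^ removed γ ρ *
    Polynomial.C (if comp γ ρ = π then 1 else 0)), fun δ => ?_⟩
  beta_reduce
  conv_lhs => rw [← (basis δ k).sum_repr (a δ), ← (basis δ k).sum_repr (b δ)]
  simp only [Finset.sum_mul_sum, smul_mul_assoc, mul_smul_comm, basis_apply,
    diagram_mul_diagram, smul_smul, map_sum, map_smul, Finsupp.coe_finsetSum, Finset.sum_apply,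
    Finsupp.smul_apply, smul_eq_mul, Polynomial.eval_finsetSum, Polynomial.eval_mul,
    Polynomial.eval_pow, Polynomial.eval_X, Polynomial.eval_C, hp, hq]
  refine Finset.sum_congr rfl fun γ _ => Finset.sum_congr rfl fun ρ _ => ?_
  rw [← basis_apply, Module.Basis.repr_self, Finsupp.single_apply]
  ring

/-- A coefficient that vanishes for all large natural numbers `n` vanishes identically. -/
theorem repr_eq_zero [CharZero K] (ha : IsPolynomialFamily a) (N : ℕ) {π : PartitionDiagram k}
    (h : ∀ n : ℕ, N ≤ n → (basis (n : K) k).repr (a n) π = 0) (δ : K) :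
    (basis δ k).repr (a δ) π = 0 := by
  obtain ⟨q, hq⟩ := ha π
  have : q = 0 := by
    refine Polynomial.eq_zero_of_infinite_isRoot q
      (((Set.Ici_infinite N).image (Nat.cast_injective (R := K)).injOn).mono ?_)
    rintro _ ⟨n, hn, rfl⟩
    rw [Set.mem_ofPred_eq, Polynomial.IsRoot, ← hq]
    exact h n hn
  rw [hq, this, Polynomial.eval_zero]

/-- Two polynomial families agree if their images on tensor space agree for all large `n`. -/
theorem eq_of_rep [CharZero K] (ha : IsPolynomialFamily a) (hb : IsPolynomialFamily b)
    (h : ∀ n : ℕ, rep K n k (a n) = rep K n k (b n)) (δ : K) : a δ = b δ := by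
  refine sub_eq_zero.1 ((basis δ k).ext_elem fun π => ?_)
  rw [map_zero, Finsupp.zero_apply]
  refine (ha.sub hb).repr_eq_zero (2 * k) (fun n hn => ?_) δ
  rw [rep_injective hn (h n), sub_self, map_zero, Finsupp.zero_apply]

end IsPolynomialFamily

theorem isPolynomialFamily_e (n : ℕ) : IsPolynomialFamily fun δ : K => e δ k n := by
  unfold e
  split_ifs
  · exact .diagram _
  · exact .diagram _

theorem isPolynomialFamily_s (n : ℕ) : IsPolynomialFamily fun δ : K => s δ k n := .diagram _

theorem isPolynomialFamily_jmData (m : ℕ) :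
    IsPolynomialFamily (fun δ : K => (jmData δ k m).Lodd) ∧
      IsPolynomialFamily (fun δ : K => (jmData δ k m).Leven) ∧
      IsPolynomialFamily (fun δ : K => (jmData δ k m).σeven) ∧
      IsPolynomialFamily (fun δ : K => (jmData δ k m).σodd) := by
  induction m with
  | zero =>
    refine ⟨?_, isPolynomialFamily_e 1, .diagram (one k), isPolynomialFamily_s 1⟩
    simpa [jmData] using IsPolynomialFamily.algebraMap (k := k) (0 : Polynomial K)
  | succ m ih =>
    obtain ⟨h1, h2, h3, h4⟩ := ih
    have s₁ := isPolynomialFamily_s (K := K) (k := k) (m + 1)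
    have s₂ := isPolynomialFamily_s (K := K) (k := k) (m + 2)
    have e₂ := isPolynomialFamily_e (K := K) (k := k) (2 * m + 2)
    have e₃ := isPolynomialFamily_e (K := K) (k := k) (2 * m + 3)
    have e₄ := isPolynomialFamily_e (K := K) (k := k) (2 * m + 4)
    have hX : IsPolynomialFamily fun δ : K => algebraMap K (DiagramAlgebra δ k) δ := by
      simpa using IsPolynomialFamily.algebraMap (k := k) (Polynomial.X : Polynomial K)
    refine ⟨?_, ?_, ?_, ?_⟩
    · exact (((((s₁.mul h1).mul s₁).sub (h2.mul e₂)).sub (e₂.mul h2)).add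
        ((hX.sub h1).mul e₂)).add h3
    · exact (((((s₁.mul h2).mul s₁).sub ((s₁.mul h2).mul e₂)).sub ((e₂.mul h2).mul s₁)).add
        (((e₂.mul h2).mul e₃).mul e₂)).add h4
    · exact ((((((((s₁.mul s₂).mul h3).mul s₂).mul s₁)).add
        ((((e₂.mul h2).mul s₂).mul e₂).mul s₂)).add
        ((((s₂.mul e₂).mul h2).mul s₂).mul e₂)).sub
        (((((e₂.mul h2).mul s₁).mul e₄).mul e₃).mul e₂)).sub
        (((((((s₂.mul e₂).mul e₃).mul e₄).mul s₁).mul h2).mul e₂).mul s₂)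
    · exact ((((((((s₁.mul s₂).mul h4).mul s₂).mul s₁)).add
        (((((s₂.mul e₂).mul h2).mul s₂).mul e₂).mul s₂)).add
        (((e₂.mul h2).mul s₂).mul e₂)).sub
        ((((((s₂.mul e₂).mul h2).mul s₁).mul e₄).mul e₃).mul e₂)).sub
        ((((((e₂.mul e₃).mul e₄).mul s₁).mul h2).mul e₂).mul s₂)

theorem isPolynomialFamily_N (i : ℕ) : IsPolynomialFamily fun δ : K => N δ k i := by
  have h2 : IsPolynomialFamily fun δ : K => algebraMap K (DiagramAlgebra δ k) (δ / 2) := by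
    have h := IsPolynomialFamily.algebraMap (k := k) 
      (Polynomial.X * Polynomial.C 2⁻¹ : Polynomial K)
    have he : ∀ δ : K, (Polynomial.X * Polynomial.C 2⁻¹ : Polynomial K).eval δ = δ / 2 :=
      fun δ => by rw [Polynomial.eval_mul, Polynomial.eval_X, Polynomial.eval_C, div_eq_mul_inv]
    simpa only [he] using h
  refine IsPolynomialFamily.sub ?_ h2
  unfold L
  split_ifs
  · exact (isPolynomialFamily_jmData _).1
  · exact (isPolynomialFamily_jmData _).2.1

/-! ### The normalised Jucys–Murphy elements -/

theorem rep_N_even [CharZero K] {n i : ℕ} (hi : i / 2 < k) (h : Even i) :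
    rep K n k (N (n : K) k (i + 1)) = algebraMap K _ ((n : K) / 2) - jmTerm K k n i := by
  have hc : (i + 1) / 2 = i / 2 := by
    obtain ⟨t, rfl⟩ := h
    omega
  have hn : (n : K) • (1 : Module.End K ((Fin k → Fin n) → K)) = algebraMap K _ (n : K) :=
    (Algebra.algebraMap_eq_smul_one _).symm
  rw [N, L, if_pos (by simpa [parity_simps] using h), map_sub, AlgHom.commutes,
    Nat.add_sub_cancel, (isModel_jmData K k n (i / 2)).Lodd hi, jmTerm, dif_pos hi, hc, hn,
    sub_right_comm, ← map_sub]
  rw [sub_half]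

theorem rep_N_odd {n i : ℕ} (hi : i / 2 < k) (h : ¬ Even i) :
    rep K n k (N (n : K) k (i + 1)) = jmTerm K k n i - algebraMap K _ ((n : K) / 2) := by
  have hc : (i + 1) / 2 = i / 2 + 1 := by
    obtain ⟨t, rfl⟩ := Nat.not_even_iff_odd.1 h
    omega
  rw [N, L, if_neg (by simpa [parity_simps] using h), map_sub, AlgHom.commutes,
    Nat.add_sub_cancel, (isModel_jmData K k n (i / 2)).Leven hi, jmTerm, dif_pos hi, hc]

theorem rep_N_eq [CharZero K] {n i : ℕ} (hi : i / 2 < k) :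
    rep K n k (N (n : K) k (i + 1)) = if Even i then
      algebraMap K _ ((n : K) / 2) - jmTerm K k n i
      else jmTerm K k n i - algebraMap K _ ((n : K) / 2) := by
  split_ifs with h
  · exact rep_N_even hi h
  · exact rep_N_odd hi h

theorem commute_rep_N [CharZero K] {n i : ℕ} (hi : i / 2 < k)
    {x : Module.End K ((Fin k → Fin n) → K)}
    (h : Commute x (jmTerm K k n i)) : Commute x (rep K n k (N (n : K) k (i + 1))) := by
  have hc : Commute x (algebraMap K _ ((n : K) / 2)) := (Algebra.commutes _ _).symm
  rw [rep_N_eq hi]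
  split_ifs
  · exact hc.sub_right h
  · exact h.sub_right hc

theorem commute_N [CharZero K] (δ : K) {i j : ℕ} (hi : i / 2 < k) (hj : j / 2 < k) :
    Commute (N δ k (i + 1)) (N δ k (j + 1)) :=
  IsPolynomialFamily.eq_of_rep ((isPolynomialFamily_N _).mul (isPolynomialFamily_N _))
    ((isPolynomialFamily_N _).mul (isPolynomialFamily_N _)) (fun n => by
      rw [map_mul, map_mul]
      exact commute_rep_N hj (commute_rep_N hi (commute_jmTerm j i)).symm) δ

/-- The matrix of `jmOp` is symmetric. -/
theorem jmOp_matrix_symm {n c : ℕ} (j : Fin k) (hc : c = j.val ∨ c = j.val + 1)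
    (u w : Fin k → Fin n) :
    (∑ b, if act (Equiv.swap (u j) b) c u = w then 1 else 0 : ℚ) =
      ∑ b, if act (Equiv.swap (w j) b) c w = u then 1 else 0 := by
  have hinv : ∀ (a b : Fin n) (u w : Fin k → Fin n), act (Equiv.swap a b) c u = w →
      act (Equiv.swap a b) c w = u := by
    rintro a b u _ rfl
    rw [← act_mul, Equiv.swap_mul_self, act_one]
  rcases hc with rfl | rfl
  · have key : ∀ (u w : Fin k → Fin n) (b : Fin n), act (Equiv.swap (u j) b) j.val u = w →
        act (Equiv.swap (w j) b) j.val w = u := by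
      intro u w b h
      have hj : w j = u j := by rw [← h, act_of_le _ _ le_rfl]
      rw [hj]
      exact hinv _ _ _ _ h
    refine Finset.sum_congr rfl fun b _ => ?_
    simp only [show act (Equiv.swap (u j) b) j.val u = w ↔ act (Equiv.swap (w j) b) j.val w = u from
      ⟨key u w b, key w u b⟩]
  · have key : ∀ u w : Fin k → Fin n,
        (∑ b, if act (Equiv.swap (u j) b) (j.val + 1) u = w then 1 else 0 : ℚ) =
          if act (Equiv.swap (u j) (w j)) (j.val + 1) u = w then 1 else 0 := by
      intro u w
      refine Finset.sum_eq_single (w j) (fun b _ hb => if_neg fun h => hb ?_) (by simp)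
      rw [← h, act_of_lt _ _ (Nat.lt_succ_self _), Equiv.swap_apply_left]
    rw [key, key, Equiv.swap_comm (w j)]
    simp only [show act (Equiv.swap (u j) (w j)) (j.val + 1) u = w ↔
      act (Equiv.swap (u j) (w j)) (j.val + 1) w = u from ⟨hinv _ _ _ _, hinv _ _ _ _⟩]

theorem isSemisimple_rep_N [CharZero K] {n i : ℕ} (hi : i / 2 < k) :
    (rep K n k (N (n : K) k (i + 1))).IsSemisimple := by
  classical
  set j : Fin k := ⟨i / 2, hi⟩ with hj
  set B : Matrix (Fin k → Fin n) (Fin k → Fin n) ℚ := Matrix.of fun u w =>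
    ∑ b, if act (Equiv.swap (u j) b) ((i + 1) / 2) u = w then 1 else 0 with hB
  have hsymm : B.transpose = B := by
    ext u w
    exact jmOp_matrix_symm j (by simp only [hj]; omega) w u
  have hJ : jmTerm K k n i = Matrix.toLin' (B.map (algebraMap ℚ K)) := by
    rw [jmTerm, dif_pos hi]
    refine LinearMap.ext fun f => funext fun u => ?_
    rw [jmOp_apply, Matrix.toLin'_apply, Matrix.mulVec, dotProduct]
    simp only [Matrix.map_apply, hB, Matrix.of_apply, map_sum, Finset.sum_mul]
    rw [Finset.sum_comm]
    refine Finset.sum_congr rfl fun b _ => ?_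
    rw [Finset.sum_eq_single (act (Equiv.swap (u j) b) ((i + 1) / 2) u)
      (fun w _ hw => by rw [if_neg hw.symm, map_zero, zero_mul]) (by simp)]
    simp [hj]
  have hn : algebraMap K (Module.End K ((Fin k → Fin n) → K)) ((n : K) / 2) =
      Matrix.toLin' (((n / 2 : ℚ) • (1 : Matrix (Fin k → Fin n) (Fin k → Fin n) ℚ)).map
        (algebraMap ℚ K)) := by
    refine LinearMap.ext fun f => ?_
    rw [Module.algebraMap_end_apply, Matrix.toLin'_apply]
    have : ((n / 2 : ℚ) • (1 : Matrix (Fin k → Fin n) (Fin k → Fin n) ℚ)).map (algebraMap ℚ K) =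
        ((n : K) / 2) • 1 := by
      ext u w
      by_cases h : u = w <;> simp [h]
    rw [this, Matrix.smul_mulVec, Matrix.one_mulVec]
  rw [rep_N_eq hi, hJ, hn, ← map_sub, ← map_sub, ← Matrix.map_sub _ (map_sub _),
    ← Matrix.map_sub _ (map_sub _)]
  split_ifs
  · exact isSemisimple_toLin'_map_of_symm _ (by rw [Matrix.transpose_sub, hsymm]; simp)
  · exact isSemisimple_toLin'_map_of_symm _ (by rw [Matrix.transpose_sub, hsymm]; simp)

/-- An element all of whose coefficients outside of `A_r(δ)` vanish lies in `A_r(δ)`. -/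
theorem mem_partitionAlgebra {r : ℕ} {δ : K} {a : DiagramAlgebra δ ((r + 1) / 2)}
    (h : ∀ π, ¬ IsDiagramOf r π → (basis δ _).repr a π = 0) : a ∈ PartitionAlgebra r δ := by
  rw [← (basis δ _).sum_repr a]
  refine sum_mem fun π _ => ?_
  by_cases hπ : IsDiagramOf r π
  · exact Subalgebra.smul_mem _ (show diagram δ π ∈ PartitionAlgebra r δ from
      Submodule.subset_span ⟨π, hπ, rfl⟩) _
  · rw [h π hπ, zero_smul]
    exact zero_mem _

theorem N_mem_partitionAlgebra [CharZero K] {r i : ℕ} (δ : K) (hi : i < r) :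
    N δ ((r + 1) / 2) (i + 1) ∈ PartitionAlgebra r δ := by
  refine mem_partitionAlgebra fun π hπ => ?_
  refine (isPolynomialFamily_N (i + 1)).repr_eq_zero (2 * ((r + 1) / 2)) (fun n hn => ?_) δ
  refine repr_eq_zero_of_rep hn _ (fun π => ¬ IsDiagramOf r π)
    (fun π γ hle hγ hπ => hγ fun hr j hj => hle (hπ hr j hj)) (fun u w huw => ?_) π hπ
  simp only [IsDiagramOf] at huw
  push Not at huw
  obtain ⟨hr, j, hj, hne⟩ := huw
  have hne : u j ≠ w j := hne
  have hi2 : i / 2 < (r + 1) / 2 := by omega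
  have hcomm : Commute (labelOp K j (u j)) (rep K n _ (N (n : K) _ (i + 1))) := by
    refine commute_rep_N hi2 ?_
    rw [jmTerm, dif_pos hi2]
    exact labelOp_commute_jmOp (by obtain ⟨t, rfl⟩ := hr; omega) _
  have h0 : labelOp K j (u j) (Pi.single w 1) = 0 := by
    funext v
    rw [labelOp_apply, Pi.zero_apply, Pi.single_apply]
    split_ifs with h1 h2
    · rw [h2] at h1
      exact absurd h1.symm hne
    · rfl
    · rfl
  have h1 := congrFun (LinearMap.congr_fun hcomm.eq (Pi.single w 1)) u
  rw [Module.End.mul_apply, Module.End.mul_apply, h0, map_zero, labelOp_apply, if_pos rfl] at h1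
  exact h1

/-! ### The evaluation homomorphism and the center -/

/-- Pairwise commuting elements define a homomorphism from the polynomial ring. -/
theorem exists_algHom_of_commute {σ A : Type*} [Ring A] [Algebra K A] (y : σ → A)
    (h : ∀ i j, Commute (y i) (y j)) :
    ∃ φ : MvPolynomial σ K →ₐ[K] A, ∀ i, φ (MvPolynomial.X i) = y i := by
  have := Algebra.isMulCommutative_adjoin K (s := Set.range y) (by
    rintro _ ⟨i, rfl⟩ _ ⟨j, rfl⟩
    exact h i j)
  let : CommRing (Algebra.adjoin K (Set.range y)) :=
    { (inferInstance : Ring (Algebra.adjoin K (Set.range y))) with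
      mul_comm := fun a b => mul_comm' a b }
  refine ⟨(Algebra.adjoin K (Set.range y)).val.comp (MvPolynomial.aeval fun i =>
    (⟨y i, Algebra.subset_adjoin ⟨i, rfl⟩⟩ : Algebra.adjoin K (Set.range y))), fun i => ?_⟩
  rw [AlgHom.comp_apply, MvPolynomial.aeval_X]
  rfl

theorem exists_evalN [CharZero K] (r : ℕ) (δ : K) :
    ∃ φ : MvPolynomial (Fin r) K →ₐ[K] PartitionAlgebra r δ, ∀ i : Fin r,
      φ (MvPolynomial.X i) = ⟨N δ ((r + 1) / 2) (i.val + 1), N_mem_partitionAlgebra δ i.isLt⟩ :=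
  exists_algHom_of_commute _ fun i j => Subtype.ext (commute_N δ (by omega) (by omega))

/-- Evaluation of polynomials at the normalised Jucys–Murphy elements. -/
noncomputable def evalN [CharZero K] (r : ℕ) (δ : K) :
    MvPolynomial (Fin r) K →ₐ[K] PartitionAlgebra r δ :=
  (exists_evalN r δ).choose

theorem evalN_X [CharZero K] {r : ℕ} (δ : K) (i : Fin r) :
    (evalN r δ (MvPolynomial.X i) : DiagramAlgebra δ ((r + 1) / 2)) =
      N δ ((r + 1) / 2) (i.val + 1) := by
  rw [evalN, (exists_evalN r δ).choose_spec]

theorem isPolynomialFamily_evalN [CharZero K] {r : ℕ} (p : MvPolynomial (Fin r) K) :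
    IsPolynomialFamily fun δ : K => (evalN r δ p : DiagramAlgebra δ ((r + 1) / 2)) := by
  induction p using MvPolynomial.induction_on with
  | C c =>
    have : ∀ δ : K, (evalN r δ (MvPolynomial.C c) : DiagramAlgebra δ ((r + 1) / 2)) =
        algebraMap K _ ((Polynomial.C c).eval δ) := fun δ => by
      rw [← MvPolynomial.algebraMap_eq, AlgHom.commutes, Polynomial.eval_C]
      rfl
    simp only [this]
    exact .algebraMap _
  | add p q hp hq =>
    simp only [map_add]
    exact hp.add hq
  | mul_X p i hp =>
    simp only [map_mul]
    refine hp.mul ?_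
    simp only [evalN_X]
    exact isPolynomialFamily_N _

open MvPolynomial in
/-- A supersymmetric polynomial in the `N_i` commutes on tensor space with everything that commutes
with the symmetric group on the labels and, for odd `r`, with the projections at the last
position. -/
theorem commute_rep_evalN [IsAlgClosed K] [CharZero K] {r n : ℕ} {p : MvPolynomial (Fin r) K}
    (hp : IsSupersymmetric p)
    {x : Module.End K ((Fin ((r + 1) / 2) → Fin n) → K)} 
    (hx : ∀ g, Commute x (actOp K _ n ((r + 1) / 2) g))
    (hx' : Odd r → ∀ j : Fin ((r + 1) / 2), j.val + 1 = (r + 1) / 2 →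
      ∀ a, Commute x (labelOp K j a)) :
    Commute x (rep K n _ (evalN r (n : K) p).val) := by
  classical
  set ψ : MvPolynomial (Fin r) K →ₐ[K] Module.End K ((Fin ((r + 1) / 2) → Fin n) → K) :=
    (rep K n _).comp ((PartitionAlgebra r (n : K)).val.comp (evalN r (n : K))) with hψ
  have hψX : ∀ i : Fin r, ψ (X i) = rep K n _ (N (n : K) _ (i.val + 1)) := fun i => by
    rw [← evalN_X]
    rfl
  set P : Polynomial K → MvPolynomial (Fin r) K := fun q => ∑ i : Fin r,
    if Even i.val then -Polynomial.aeval (-X i) q else Polynomial.aeval (X i) q with hP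
  -- `P q` is the supersymmetric sum of `q`; on tensor space the signs and the shift by `n / 2`
  -- turn it into the telescoping sum for a shifted polynomial.
  refine commute_of_eval_eq ψ (fun i => ?_) (Set.range P) ?_ (p := p) fun χ χ' h => ?_
  · rw [hψX]
    exact isSemisimple_rep_N (by omega)
  · rintro _ ⟨q, rfl⟩
    have h := commute_sum_aeval_jmTerm rfl hx hx'
      (q.comp (Polynomial.X - Polynomial.C ((n : K) / 2)))
    convert h using 1
    rw [hP, map_sum, Finset.sum_range]
    refine Finset.sum_congr rfl fun i _ => ?_
    have hi : i.val / 2 < (r + 1) / 2 := by omega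
    have hcomp : Polynomial.aeval (jmTerm K ((r + 1) / 2) n i)
        (q.comp (Polynomial.X - Polynomial.C ((n : K) / 2))) =
        Polynomial.aeval (jmTerm K ((r + 1) / 2) n i - algebraMap K _ ((n : K) / 2)) q := by
      rw [Polynomial.aeval_comp, map_sub, Polynomial.aeval_X, Polynomial.aeval_C]
    rw [hcomp]
    split_ifs with he
    · rw [map_neg, ← Polynomial.aeval_algHom_apply, map_neg, hψX, rep_N_even hi he, neg_sub]
    · rw [← Polynomial.aeval_algHom_apply, hψX, rep_N_odd hi he]
  · refine hp.eval_eq_of_signedSum_eq χ χ' fun g => ?_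
    have hPq : ∀ (χ : Fin r → K) q,
        eval χ (P q) = IsSupersymmetric.signedSum χ fun y => q.eval y := by
      intro χ q
      rw [hP, map_sum, IsSupersymmetric.signedSum]
      refine Finset.sum_congr rfl fun i _ => ?_
      have key : ∀ t, eval χ (Polynomial.aeval t q) = q.eval (eval χ t) := fun t => by
        have := Polynomial.aeval_algHom_apply (MvPolynomial.aeval χ) t q
        simpa [coe_aeval_eq_eval] using this.symm
      split_ifs
      · rw [map_neg, key, map_neg, eval_X]
      · rw [key, eval_X]
    -- On the finitely many values that occur, `g` agrees with an interpolating polynomial.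
    set S : Finset K := (Finset.univ.image χ ∪ Finset.univ.image χ') ∪
      (Finset.univ.image (-χ) ∪ Finset.univ.image (-χ'))
    set q := Lagrange.interpolate S id g
    have hq : ∀ y ∈ S, g y = q.eval y := fun y hy =>
      (Lagrange.eval_interpolate_at_node g (Function.injective_id.injOn) hy).symm
    have hg : ∀ ξ : Fin r → K, (∀ i, ξ i ∈ S ∧ -ξ i ∈ S) → IsSupersymmetric.signedSum ξ g =
        IsSupersymmetric.signedSum ξ fun y => q.eval y := by
      intro ξ hξ
      refine Finset.sum_congr rfl fun i _ => ?_
      rw [hq _ (hξ i).1, hq _ (hξ i).2]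
    have h1 : ∀ i, χ i ∈ S ∧ -χ i ∈ S := fun i => by
      constructor
      · simp [S]
      · simp only [S, Finset.mem_union, Finset.mem_image]
        exact Or.inr (Or.inl ⟨i, Finset.mem_univ _, rfl⟩)
    have h2 : ∀ i, χ' i ∈ S ∧ -χ' i ∈ S := fun i => by
      constructor
      · simp [S]
      · simp only [S, Finset.mem_union, Finset.mem_image]
        exact Or.inr (Or.inr ⟨i, Finset.mem_univ _, rfl⟩)
    rw [hg χ h1, hg χ' h2, ← hPq, ← hPq]
    exact h _ ⟨q, rfl⟩

theorem commute_evalN_diagram [IsAlgClosed K] [CharZero K] {r : ℕ} {p : MvPolynomial (Fin r) K}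
    (hp : IsSupersymmetric p) (δ : K) {π : PartitionDiagram ((r + 1) / 2)}
    (hπ : IsDiagramOf r π) : Commute (diagram δ π) (evalN r δ p).val := by
  refine IsPolynomialFamily.eq_of_rep (a := fun δ => diagram δ π * (evalN r δ p).val)
    (b := fun δ => (evalN r δ p).val * diagram δ π)
    ((IsPolynomialFamily.diagram π).mul (isPolynomialFamily_evalN p))
    ((isPolynomialFamily_evalN p).mul (.diagram π)) (fun n => ?_) δ
  rw [map_mul, map_mul, rep_diagram]
  exact commute_rep_evalN hp (diagramOp_commute_actOp π)
    fun hr j hj => diagramOp_commute_labelOp (hπ hr j hj)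

end DiagramAlgebra

theorem mainTheorem1 {K : Type*} [Field K] [IsAlgClosed K] [CharZero K] (r : ℕ) (δ : K) :
    ∃ φ : MvPolynomial (Fin r) K →ₐ[K] PartitionAlgebra r δ,
      (∀ i : Fin r, (φ (MvPolynomial.X i) : DiagramAlgebra δ ((r + 1) / 2)) =
        DiagramAlgebra.N δ ((r + 1) / 2) (i.val + 1)) ∧
      ∀ p : MvPolynomial (Fin r) K, IsSupersymmetric p →
        φ p ∈ Subalgebra.center K (PartitionAlgebra r δ) := by
  refine ⟨DiagramAlgebra.evalN r δ, DiagramAlgebra.evalN_X δ, fun p hp => ?_⟩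
  rw [Subalgebra.mem_center_iff]
  rintro ⟨b, hb'⟩
  refine Subtype.ext ?_
  have hb : b ∈ Submodule.span K (DiagramAlgebra.diagram δ '' {π | IsDiagramOf r π}) := hb'
  show Commute b (DiagramAlgebra.evalN r δ p).val
  clear hb'
  induction hb using Submodule.span_induction with
  | mem x hx =>
    obtain ⟨π, hπ, rfl⟩ := hx
    exact DiagramAlgebra.commute_evalN_diagram hp δ hπ
  | zero => exact Commute.zero_left _
  | add x y _ _ hx hy => exact hx.add_left hy
  | smul c x _ hx => exact hx.smul_left c
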